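/- Let $n,m\ge 0$ be integers and let $u=(u^1,\dots,u^m):\mathbb{R}^n\to\mathbb{R}^m$ be a smooth map. Write $u^\alpha_i=\partial u^\alpha/\partial x_i$, $u^\alpha_{ij}=\partial^2u^\alpha/\partial x_i\partial x_j$, let $$g_{ij}=\delta_{ij}+\sum_{\alpha=1}^m u^\alpha_iu^\alpha_j$$ be the metric induced on the graph $M=\{(x,u(x)):x\in\mathbb{R}^n\}\subset\mathbb{R}^{n+m}$ by the Euclidean metric, let $(g^{ij})$ be the inverse matrix of $(g_{ij})$, and let $\lambda_i(x)\ge 0$ be the singular values of $du$ at $x$, listed with multiplicity and completed by zeros. Assume that $u$ solves on all of $\mathbb{R}^n$ the self-shrinker system $$\sum_{i,j=1}^n g^{ij}u^\alpha_{ij}=-u^\alpha+\sum_{i=1}^n x_iu^\alpha_i,\qquad \alpha=1,\dots,m$$ (equivalently, $M$ is a self-shrinker: its mean curvature vector satisfies $H=-X^N$, where $X^N$ is the normal part of the position vector $X$). Assume moreover that at least one of the following three conditions holds: (i) $\lambda_i(x)\lambda_j(x)\le 1$ for all $i\ne j$ and all $x\in\mathbb{R}^n$; (ii) there is a positive constant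 $\beta<9$ such that $\det(g_{ij}(x))\le\beta$ for all $x\in\mathbb{R}^n$; (iii) $\sum_{i,j}u^\alpha_{qi}g^{ij}u^\beta_{jp}=\sum_{i,j}u^\beta_{qi}g^{ij}u^\alpha_{jp}$ on $\mathbb{R}^n$ for all $\alpha,\beta\in\{1,\dots,m\}$ and $p,q\in\{1,\dots,n\}$. Then $M$ is a linear subspace of $\mathbb{R}^{n+m}$. -/

import Mathlib

open scoped ContDiff

namespace ShrinkerGraph

noncomputable section

/-- The partial derivative `∂f/∂xᵢ` of a real function on `ℝⁿ`. -/
def partialDeriv {n : ℕ} (f : EuclideanSpace ℝ (Fin n) → ℝ) (i : Fin n)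
    (x : EuclideanSpace ℝ (Fin n)) : ℝ :=
  fderiv ℝ f x (EuclideanSpace.single i (1 : ℝ))

/-- `u^α_i = ∂u^α/∂xᵢ`. -/
def d1 {n m : ℕ} (u : EuclideanSpace ℝ (Fin n) → EuclideanSpace ℝ (Fin m))
    (α : Fin m) (i : Fin n) (x : EuclideanSpace ℝ (Fin n)) : ℝ :=
  partialDeriv (fun y => u y α) i x

/-- `u^α_{ij} = ∂²u^α/∂xᵢ∂xⱼ`. -/
def d2 {n m : ℕ} (u : EuclideanSpace ℝ (Fin n) → EuclideanSpace ℝ (Fin m))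
    (α : Fin m) (i j : Fin n) (x : EuclideanSpace ℝ (Fin n)) : ℝ :=
  partialDeriv (fun y => d1 u α i y) j x

/-- The metric `g_{ij} = δ_{ij} + ∑_α u^α_i u^α_j` induced on the graph of `u` by the Euclidean
metric of `ℝ^{n+m}`. -/
def inducedMetric {n m : ℕ} (u : EuclideanSpace ℝ (Fin n) → EuclideanSpace ℝ (Fin m))
    (x : EuclideanSpace ℝ (Fin n)) : Matrix (Fin n) (Fin n) ℝ :=
  Matrix.of fun i j => (if i = j then 1 else 0) + ∑ α, d1 u α i x * d1 u α j x

/-- The inverse metric `g^{ij}`. -/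
def inverseMetric {n m : ℕ} (u : EuclideanSpace ℝ (Fin n) → EuclideanSpace ℝ (Fin m))
    (x : EuclideanSpace ℝ (Fin n)) : Matrix (Fin n) (Fin n) ℝ :=
  (inducedMetric u x)⁻¹

/-- The matrix `(g_{ij})` is positive definite, so that `inverseMetric` is its true inverse. -/
theorem inducedMetric_posDef {n m : ℕ}
    (u : EuclideanSpace ℝ (Fin n) → EuclideanSpace ℝ (Fin m))
    (x : EuclideanSpace ℝ (Fin n)) : (inducedMetric u x).PosDef := by
  have h : inducedMetric u x = 1 + (Matrix.of fun α i => d1 u α i x).conjTranspose *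
      (Matrix.of fun α i => d1 u α i x) := by
    ext i j
    simp [inducedMetric, Matrix.mul_apply, Matrix.one_apply]
  rw [h]
  exact Matrix.PosDef.one.add_posSemidef (Matrix.posSemidef_conjTranspose_mul_self _)

/-- The self-shrinker system for graphs: `∑_{i,j} g^{ij} u^α_{ij} = -u^α + x · Du^α` on `ℝⁿ`
for every `α`. -/
def IsSelfShrinkerSolution {n m : ℕ}
    (u : EuclideanSpace ℝ (Fin n) → EuclideanSpace ℝ (Fin m)) : Prop :=
  ∀ (x : EuclideanSpace ℝ (Fin n)) (α : Fin m),
    ∑ i, ∑ j, inverseMetric u x i j * d2 u α i j x = -(u x α) + ∑ i, x i * d1 u α i x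

/-- The singular values of `du` at `x`, in descending order with multiplicity, extended by `0`
beyond the first `n`. -/
def singularValue {n m : ℕ} (u : EuclideanSpace ℝ (Fin n) → EuclideanSpace ℝ (Fin m))
    (x : EuclideanSpace ℝ (Fin n)) (i : ℕ) : ℝ :=
  (fderiv ℝ u x).toLinearMap.singularValues i

/-- The commutation condition `u^α_{qi} g^{ij} u^β_{jp} = u^β_{qi} g^{ij} u^α_{jp}`
(summed over `i, j`) for all `α, β, q, p`, at every point. -/
def SecondDerivativesCommute {n m : ℕ}
    (u : EuclideanSpace ℝ (Fin n) → EuclideanSpace ℝ (Fin m)) : Prop :=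
  ∀ (x : EuclideanSpace ℝ (Fin n)) (α β : Fin m) (q p : Fin n),
    ∑ i, ∑ j, d2 u α q i x * inverseMetric u x i j * d2 u β j p x =
      ∑ i, ∑ j, d2 u β q i x * inverseMetric u x i j * d2 u α j p x

/-- The graph `M = {(x, u(x)) : x ∈ ℝⁿ}` in `ℝⁿ × ℝᵐ` with the Euclidean (`ℓ²`) structure. -/
def graph {n m : ℕ} (u : EuclideanSpace ℝ (Fin n) → EuclideanSpace ℝ (Fin m)) :
    Set (WithLp 2 (EuclideanSpace ℝ (Fin n) × EuclideanSpace ℝ (Fin m))) :=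
  Set.range fun x => WithLp.toLp 2 (x, u x)

end

end ShrinkerGraph

namespace ShrinkerGraph

noncomputable section

variable {n m : ℕ}

/-! Let `f = logVolume u`, the logarithm of `√(det g)`, and let `L = g^{ij}∂ᵢ∂ⱼ - x·∇`, which on a
self-shrinking graph is the intrinsic drift Laplacian. Differentiating the system once eliminates
the third derivatives of `u` from `L f`. In a singular value frame of `du`, `exists_secondForm` then
gives `L f = R + ∑ h_{aik}² + ∑ λ_a λ_i h_{aik} h_{iak}` and `|∇f|² = ∑_k S_k²`, with `S_k = ∑_i λ_i
h_{iik}`. Here `h` collects the components of the second fundamental form along the normals paired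
with nonzero `λ_a`, and `R ≥ 0` is the part of the Hessian of `u` orthogonal to the image of `du`.

Suppose that for some `t ≠ 0` the quadratic form in `h` coming from `L f - R + t|∇f|²` is positive
definite. Then `t⁻¹ e^{t f}` is a subsolution of `L`. If it is bounded above it attains its maximum,
because `tr g⁻¹ ≤ n` makes the drift confining outside the ball of radius `√n`; Hopf's strong
maximum principle makes it constant. So `f` is constant, `R` and `h` vanish, and with them the
Hessian of `u`. The system reduces to `u = x·Du` with constant `Du`, so `u` is linear.

Each condition supplies its own `t`. For (i), `t = -1/(n+1)`: the diagonal of the indefinite term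
absorbs `|S|²/(n+1)`, and `λ_a λ_i ≤ 1` handles the rest (`eq_zero_of_pairwise_mul_le_one`). For
(ii), `t = 2`: `e^{2f} = det g` is bounded, and `det g < 9` gives definiteness
(`eq_zero_of_prod_lt_nine`). For (iii), `t = -1`: commutation turns the indefinite term into `|S|²`,
which leaves `∑ h²`. A negative `t` needs no bound on `f`, since then `t⁻¹ e^{t f} ≤ 0`. -/

/-! ### Calculus of partial derivatives and the second derivative test. -/

theorem partialDeriv_of_hasFDerivAt {f : EuclideanSpace ℝ (Fin n) → ℝ}
    {f' : EuclideanSpace ℝ (Fin n) →L[ℝ] ℝ} {x : EuclideanSpace ℝ (Fin n)}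
    (h : HasFDerivAt f f' x) (i : Fin n) :
    partialDeriv f i x = f' (EuclideanSpace.single i 1) := by
  rw [partialDeriv, h.fderiv]

theorem contDiff_partialDeriv {f : EuclideanSpace ℝ (Fin n) → ℝ} (hf : ContDiff ℝ ∞ f)
    (i : Fin n) : ContDiff ℝ ∞ (partialDeriv f i) :=
  (hf.fderiv_right (m := ∞) (by simp)).clm_apply contDiff_const

theorem contDiff_smooth_differentiable {f : EuclideanSpace ℝ (Fin n) → ℝ}
    (hf : ContDiff ℝ ∞ f) : Differentiable ℝ f :=
  hf.differentiable (by simp)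

theorem partialDeriv_add {f g : EuclideanSpace ℝ (Fin n) → ℝ} (hf : Differentiable ℝ f)
    (hg : Differentiable ℝ g) (i : Fin n) :
    partialDeriv (fun y => f y + g y) i = fun x => partialDeriv f i x + partialDeriv g i x := by
  ext x
  rw [partialDeriv_of_hasFDerivAt ((hf x).hasFDerivAt.fun_add (hg x).hasFDerivAt)]
  rfl

theorem partialDeriv_mul {f g : EuclideanSpace ℝ (Fin n) → ℝ} (hf : Differentiable ℝ f)
    (hg : Differentiable ℝ g) (i : Fin n) :
    partialDeriv (fun y => f y * g y) i =
      fun x => partialDeriv f i x * g x + f x * partialDeriv g i x := by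
  ext x
  rw [partialDeriv_of_hasFDerivAt ((hf x).hasFDerivAt.fun_mul (hg x).hasFDerivAt)]
  simp [partialDeriv]
  ring

theorem partialDeriv_const (c : ℝ) (i : Fin n) :
    partialDeriv (fun _ : EuclideanSpace ℝ (Fin n) => c) i = fun _ => 0 := by
  ext x
  simp [partialDeriv]

theorem partialDeriv_const_mul {f : EuclideanSpace ℝ (Fin n) → ℝ} (hf : Differentiable ℝ f)
    (c : ℝ) (i : Fin n) :
    partialDeriv (fun y => c * f y) i = fun x => c * partialDeriv f i x := by
  rw [partialDeriv_mul (by fun_prop) hf]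
  simp [partialDeriv_const]

theorem partialDeriv_neg (f : EuclideanSpace ℝ (Fin n) → ℝ) (i : Fin n) :
    partialDeriv (fun y => -f y) i = fun x => -partialDeriv f i x := by
  ext x
  simp [partialDeriv]

theorem partialDeriv_sum {ι : Type*} {s : Finset ι} {f : ι → EuclideanSpace ℝ (Fin n) → ℝ}
    (hf : ∀ k, Differentiable ℝ (f k)) (i : Fin n) :
    partialDeriv (fun y => ∑ k ∈ s, f k y) i = fun x => ∑ k ∈ s, partialDeriv (f k) i x := by
  ext x
  rw [partialDeriv_of_hasFDerivAt (HasFDerivAt.fun_sum fun k _ => (hf k x).hasFDerivAt)]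
  simp [partialDeriv]

theorem partialDeriv_comp {f : EuclideanSpace ℝ (Fin n) → ℝ} (hf : Differentiable ℝ f)
    {g g' : ℝ → ℝ} (hg : ∀ x, HasDerivAt g (g' (f x)) (f x)) (i : Fin n) :
    partialDeriv (fun y => g (f y)) i = fun x => g' (f x) * partialDeriv f i x := by
  ext x
  have h : HasFDerivAt (fun y => g (f y)) (g' (f x) • fderiv ℝ f x) x :=
    (hg x).comp_hasFDerivAt x (hf x).hasFDerivAt
  rw [partialDeriv_of_hasFDerivAt h]
  simp [partialDeriv]

theorem partialDeriv_coord (i j : Fin n) :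
    partialDeriv (fun y : EuclideanSpace ℝ (Fin n) => y j) i =
      fun _ => if i = j then 1 else 0 := by
  ext x
  have h : HasFDerivAt (fun y : EuclideanSpace ℝ (Fin n) => y j)
      (EuclideanSpace.proj (𝕜 := ℝ) j) x := (EuclideanSpace.proj (𝕜 := ℝ) j).hasFDerivAt
  rw [partialDeriv_of_hasFDerivAt h]
  simp [eq_comm]

theorem fderiv_apply_eq_sum (f : EuclideanSpace ℝ (Fin n) → ℝ)
    (x v : EuclideanSpace ℝ (Fin n)) :
    fderiv ℝ f x v = ∑ i, v i * partialDeriv f i x := by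
  have hv : v = ∑ i, v i • EuclideanSpace.single i (1 : ℝ) := by
    ext j
    simp [Pi.single_apply]
  conv_lhs => rw [hv]
  simp [partialDeriv]

theorem partialDeriv_comm {f : EuclideanSpace ℝ (Fin n) → ℝ} (hf : ContDiff ℝ ∞ f)
    (i j : Fin n) (x : EuclideanSpace ℝ (Fin n)) :
    partialDeriv (partialDeriv f i) j x = partialDeriv (partialDeriv f j) i x := by
  have hd : DifferentiableAt ℝ (fderiv ℝ f) x :=
    (hf.fderiv_right (m := ∞) (by simp)).differentiable (by simp) x
  have key : ∀ i j, partialDeriv (partialDeriv f i) j x =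
      fderiv ℝ (fderiv ℝ f) x (EuclideanSpace.single j 1) (EuclideanSpace.single i 1) := by
    intro i j
    rw [partialDeriv_of_hasFDerivAt (f := partialDeriv f i)
      (hd.hasFDerivAt.clm_apply (hasFDerivAt_const _ _))]
    simp
  rw [key, key]
  exact (hf.contDiffAt.isSymmSndFDerivAt
    (by simpa using WithTop.coe_le_coe.2 (le_top : (2 : ℕ∞) ≤ ⊤))) _ _

/-- The second derivative test: at a local maximum the Hessian is negative semidefinite. -/
theorem hessian_nonpos_of_isLocalMax {f : EuclideanSpace ℝ (Fin n) → ℝ} (hf : ContDiff ℝ ∞ f)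
    {x : EuclideanSpace ℝ (Fin n)} (hx : IsLocalMax f x) (v : EuclideanSpace ℝ (Fin n)) :
    ∑ i, ∑ j, v i * v j * partialDeriv (partialDeriv f i) j x ≤ 0 := by
  set γ : ℝ → EuclideanSpace ℝ (Fin n) := fun t => x + t • v with hγ
  have hγd : ∀ t, HasDerivAt γ v t := fun t => by
    simpa [hγ] using ((hasDerivAt_id t).smul_const v).const_add x
  have comp : ∀ g : EuclideanSpace ℝ (Fin n) → ℝ, ContDiff ℝ ∞ g → ∀ t,
      HasDerivAt (fun t => g (γ t)) (∑ i, v i * partialDeriv g i (γ t)) t := by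
    intro g hg t
    rw [← fderiv_apply_eq_sum]
    exact ((contDiff_smooth_differentiable hg) (γ t)).hasFDerivAt.comp_hasDerivAt t (hγd t)
  have h1 : deriv (fun t => f (γ t)) = fun t => ∑ i, v i * partialDeriv f i (γ t) :=
    funext fun t => (comp f hf t).deriv
  have h2 : deriv (deriv fun t => f (γ t)) 0 =
      ∑ i, ∑ j, v i * v j * partialDeriv (partialDeriv f i) j x := by
    rw [h1]
    have := HasDerivAt.fun_sum (u := Finset.univ)
      fun i (_ : i ∈ Finset.univ) =>
        (comp _ (contDiff_partialDeriv hf i) 0).const_mul (v i)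
    rw [this.deriv]
    simp [hγ, Finset.mul_sum, mul_assoc]
  have h0 : γ 0 = x := by simp [hγ]
  have hmax : IsLocalMax (fun t => f (γ t)) 0 := by
    have hx' : IsLocalMax f (γ 0) := by rwa [h0]
    exact hx'.comp_continuous (hγd 0).continuousAt
  by_contra hcon
  push Not at hcon
  rw [← h2] at hcon
  -- A positive second derivative would make 0 a local minimum as well as a local maximum, so the
  -- restriction to the line would be locally constant, with zero second derivative.
  have hmin := isLocalMin_of_deriv_deriv_pos hcon hmax.deriv_eq_zero (comp f hf 0).continuousAt
  have hconst : (fun t => f (γ t)) =ᶠ[nhds 0] fun _ => f (γ 0) := by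
    filter_upwards [hmin, hmax] with t a b using le_antisymm b a
  have : deriv (deriv fun t => f (γ t)) 0 = 0 := by
    rw [hconst.deriv.deriv_eq]
    simp
  linarith

theorem partialDeriv_eq_zero_of_isLocalMax {f : EuclideanSpace ℝ (Fin n) → ℝ}
    {x : EuclideanSpace ℝ (Fin n)} (hx : IsLocalMax f x) (i : Fin n) : partialDeriv f i x = 0 := by
  rw [partialDeriv, hx.fderiv_eq_zero]
  rfl

/-! ### The drift operator and its maximum principles. -/

/-- The drift operator `a^{ij} ∂ᵢ∂ⱼ - x · ∇`. -/
def driftOp (a : EuclideanSpace ℝ (Fin n) → Matrix (Fin n) (Fin n) ℝ)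
    (f : EuclideanSpace ℝ (Fin n) → ℝ) (x : EuclideanSpace ℝ (Fin n)) : ℝ :=
  ∑ i, ∑ j, a x i j * partialDeriv (partialDeriv f i) j x - ∑ i, x i * partialDeriv f i x

/-- The squared norm `a^{ij} ∂ᵢf ∂ⱼf`. -/
def gradSq (a : EuclideanSpace ℝ (Fin n) → Matrix (Fin n) (Fin n) ℝ)
    (f : EuclideanSpace ℝ (Fin n) → ℝ) (x : EuclideanSpace ℝ (Fin n)) : ℝ :=
  ∑ i, ∑ j, a x i j * (partialDeriv f i x * partialDeriv f j x)

variable {a : EuclideanSpace ℝ (Fin n) → Matrix (Fin n) (Fin n) ℝ}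

theorem driftOp_add {f g : EuclideanSpace ℝ (Fin n) → ℝ} (hf : ContDiff ℝ ∞ f)
    (hg : ContDiff ℝ ∞ g) (x : EuclideanSpace ℝ (Fin n)) :
    driftOp a (fun y => f y + g y) x = driftOp a f x + driftOp a g x := by
  have h1 : ∀ i, partialDeriv (fun y => f y + g y) i =
      fun y => partialDeriv f i y + partialDeriv g i y := fun i =>
    partialDeriv_add (contDiff_smooth_differentiable hf) (contDiff_smooth_differentiable hg) i
  have h2 : ∀ i j, partialDeriv (fun y => partialDeriv f i y + partialDeriv g i y) j =
      fun y => partialDeriv (partialDeriv f i) j y + partialDeriv (partialDeriv g i) j y :=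
    fun i j => partialDeriv_add (contDiff_smooth_differentiable (contDiff_partialDeriv hf i))
      (contDiff_smooth_differentiable (contDiff_partialDeriv hg i)) j
  simp only [driftOp, h1, h2, mul_add, Finset.sum_add_distrib]
  ring

theorem driftOp_const_mul {f : EuclideanSpace ℝ (Fin n) → ℝ} (hf : ContDiff ℝ ∞ f) (c : ℝ)
    (x : EuclideanSpace ℝ (Fin n)) :
    driftOp a (fun y => c * f y) x = c * driftOp a f x := by
  have h1 : ∀ i, partialDeriv (fun y => c * f y) i = fun y => c * partialDeriv f i y :=
    fun i => partialDeriv_const_mul (contDiff_smooth_differentiable hf) c i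
  have h2 : ∀ i j, partialDeriv (fun y => c * partialDeriv f i y) j =
      fun y => c * partialDeriv (partialDeriv f i) j y :=
    fun i j => partialDeriv_const_mul
      (contDiff_smooth_differentiable (contDiff_partialDeriv hf i)) c j
  simp only [driftOp, h1, h2, mul_sub, Finset.mul_sum]
  congr 1
  · exact Finset.sum_congr rfl fun i _ => Finset.sum_congr rfl fun j _ => by ring
  · exact Finset.sum_congr rfl fun i _ => by ring

theorem driftOp_exp {f : EuclideanSpace ℝ (Fin n) → ℝ} (hf : ContDiff ℝ ∞ f) (t : ℝ)
    (x : EuclideanSpace ℝ (Fin n)) :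
    driftOp a (fun y => Real.exp (t * f y)) x =
      Real.exp (t * f x) * (t * driftOp a f x + t ^ 2 * gradSq a f x) := by
  have hd := contDiff_smooth_differentiable hf
  have h1 : ∀ i, partialDeriv (fun y => Real.exp (t * f y)) i =
      fun y => (t * Real.exp (t * f y)) * partialDeriv f i y := fun i =>
    partialDeriv_comp hd (g := fun s => Real.exp (t * s)) (g' := fun s => t * Real.exp (t * s))
      (fun y => by
        have := ((hasDerivAt_id (f y)).const_mul t).exp
        simpa [mul_comm] using this) i
  have h2 : ∀ i j, partialDeriv (fun y => (t * Real.exp (t * f y)) * partialDeriv f i y) j =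
      fun y => Real.exp (t * f y) * (t * partialDeriv (partialDeriv f i) j y +
        t ^ 2 * (partialDeriv f i y * partialDeriv f j y)) := by
    intro i j
    rw [partialDeriv_mul (by fun_prop)
      (contDiff_smooth_differentiable (contDiff_partialDeriv hf i)),
      partialDeriv_const_mul (by fun_prop), h1]
    ext y
    ring
  simp only [driftOp, h1, h2, gradSq, Finset.mul_sum, mul_add, mul_sub]
  rw [← add_sub_right_comm, ← Finset.sum_add_distrib]
  congr 1
  · refine Finset.sum_congr rfl fun i _ => ?_
    rw [← Finset.sum_add_distrib]
    exact Finset.sum_congr rfl fun j _ => by ring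
  · exact Finset.sum_congr rfl fun i _ => by ring

theorem driftOp_nonpos_of_isLocalMax {f : EuclideanSpace ℝ (Fin n) → ℝ} (hf : ContDiff ℝ ∞ f)
    {x : EuclideanSpace ℝ (Fin n)} (ha : (a x).PosSemidef) (hx : IsLocalMax f x) :
    driftOp a f x ≤ 0 := by
  have hgrad : ∀ i, partialDeriv f i x = 0 := partialDeriv_eq_zero_of_isLocalMax hx
  simp only [driftOp, hgrad, mul_zero, Finset.sum_const_zero, sub_zero]
  -- Splitting `a x` into rank-one terms `v vᵀ` reduces the claim to the Hessian in single
  -- directions.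
  obtain ⟨N, v, hv⟩ := Matrix.posSemidef_iff_eq_sum_vecMulVec.mp ha
  have hterm : ∀ i j, a x i j * partialDeriv (partialDeriv f i) j x =
      ∑ k, v k i * v k j * partialDeriv (partialDeriv f i) j x := by
    intro i j
    rw [← Finset.sum_mul, hv]
    simp [Matrix.sum_apply, Matrix.vecMulVec_apply]
  simp only [hterm]
  have hswap : ∑ i, ∑ j, ∑ k, v k i * v k j * partialDeriv (partialDeriv f i) j x =
      ∑ k, ∑ i, ∑ j, v k i * v k j * partialDeriv (partialDeriv f i) j x := by
    rw [Finset.sum_comm]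
    simp_rw [Finset.sum_comm (s := Finset.univ (α := Fin N))]
    rw [Finset.sum_comm]
  rw [hswap]
  exact Finset.sum_nonpos fun k _ => hessian_nonpos_of_isLocalMax hf hx (WithLp.toLp 2 (v k))

theorem continuous_driftOp (hac : ∀ i j, Continuous fun x => a x i j)
    {f : EuclideanSpace ℝ (Fin n) → ℝ} (hf : ContDiff ℝ ∞ f) : Continuous (driftOp a f) := by
  have h1 : ∀ i, Continuous (partialDeriv f i) := fun i => (contDiff_partialDeriv hf i).continuous
  have h2 : ∀ i j, Continuous (partialDeriv (partialDeriv f i) j) := fun i j =>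
    (contDiff_partialDeriv (contDiff_partialDeriv hf i) j).continuous
  unfold driftOp
  fun_prop

theorem continuous_gradSq (hac : ∀ i j, Continuous fun x => a x i j)
    {f : EuclideanSpace ℝ (Fin n) → ℝ} (hf : ContDiff ℝ ∞ f) : Continuous (gradSq a f) := by
  have h1 : ∀ i, Continuous (partialDeriv f i) := fun i => (contDiff_partialDeriv hf i).continuous
  unfold gradSq
  fun_prop

theorem contDiff_normSq_sub (y : EuclideanSpace ℝ (Fin n)) :
    ContDiff ℝ ∞ fun z : EuclideanSpace ℝ (Fin n) => ‖z - y‖ ^ 2 :=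
  (contDiff_id.sub contDiff_const).norm_sq ℝ

theorem partialDeriv_normSq_sub (y : EuclideanSpace ℝ (Fin n)) (i : Fin n) :
    partialDeriv (fun z => ‖z - y‖ ^ 2) i = fun x => 2 * (x i + -y i) := by
  ext x
  have h : HasFDerivAt (fun z : EuclideanSpace ℝ (Fin n) => ‖z - y‖ ^ 2)
    (2 • (innerSL ℝ (x - y)).comp (ContinuousLinearMap.id ℝ _)) x :=
    ((hasFDerivAt_id x).sub_const y).norm_sq
  rw [partialDeriv_of_hasFDerivAt h]
  simp [EuclideanSpace.inner_single_right, sub_eq_add_neg]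
  ring

theorem driftOp_normSq (x : EuclideanSpace ℝ (Fin n)) :
    driftOp a (fun z => ‖z‖ ^ 2) x = 2 * (a x).trace - 2 * ‖x‖ ^ 2 := by
  have h1 : ∀ i, partialDeriv (fun z : EuclideanSpace ℝ (Fin n) => ‖z‖ ^ 2) i =
      fun x => 2 * x i := fun i => by simpa using partialDeriv_normSq_sub (n := n) 0 i
  have h2 : ∀ i j, partialDeriv (fun x : EuclideanSpace ℝ (Fin n) => 2 * x i) j =
      fun _ => 2 * if j = i then 1 else 0 := fun i j => by
    rw [partialDeriv_const_mul (by fun_prop), partialDeriv_coord]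
  simp only [driftOp, h1, h2]
  simp only [EuclideanSpace.real_norm_sq_eq, Matrix.trace, Finset.mul_sum]
  congr 1
  · refine Finset.sum_congr rfl fun i _ => ?_
    rw [Finset.sum_eq_single i (fun j _ h => by simp [h]) (by simp)]
    simp [mul_comm]
  · exact Finset.sum_congr rfl fun i _ => by ring

theorem gradSq_normSq_sub_pos {x y : EuclideanSpace ℝ (Fin n)} (ha : (a x).PosDef) (h : x ≠ y) :
    0 < gradSq a (fun z => ‖z - y‖ ^ 2) x := by
  have hne : (fun i => x i + -y i) ≠ 0 := fun h0 => h (by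
    ext i
    have := congrFun h0 i
    simp only [Pi.zero_apply] at this
    linarith)
  have hpos := ha.dotProduct_mulVec_pos hne
  have : gradSq a (fun z => ‖z - y‖ ^ 2) x =
      4 * (star (fun i => x i + -y i) ⬝ᵥ (a x).mulVec (fun i => x i + -y i)) := by
    simp only [gradSq, partialDeriv_normSq_sub, dotProduct, Matrix.mulVec, Finset.mul_sum]
    exact Finset.sum_congr rfl fun i _ => Finset.sum_congr rfl fun j _ => by
      simp only [star_trivial]
      ring
  rw [this]
  positivity

/-- Hopf's strong maximum principle for the drift operator. -/
theorem eq_of_driftOp_nonneg_of_forall_le (hac : ∀ i j, Continuous fun x => a x i j)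
    (hpd : ∀ x, (a x).PosDef) {f : EuclideanSpace ℝ (Fin n) → ℝ} (hf : ContDiff ℝ ∞ f)
    (hL : ∀ x, 0 ≤ driftOp a f x) {x₀ : EuclideanSpace ℝ (Fin n)} (hmax : ∀ x, f x ≤ f x₀)
    (x : EuclideanSpace ℝ (Fin n)) : f x = f x₀ := by
  by_contra hz
  set Z : Set (EuclideanSpace ℝ (Fin n)) := {y | f y = f x₀} with hZ
  have hZc : IsClosed Z := isClosed_eq hf.continuous continuous_const
  -- The ball with diameter from `x` to its nearest maximum point `p` meets the maximum set only at
  -- `p`.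
  obtain ⟨p, hpZ, hp⟩ := hZc.exists_infDist_eq_dist ⟨x₀, rfl⟩ x
  have hxp : x ≠ p := fun h => hz (h ▸ hpZ)
  set y := midpoint ℝ x p with hy
  set ρ := dist x p / 2 with hρ
  have hρ0 : 0 < ρ := by
    have := dist_pos.2 hxp
    positivity
  have hyx : dist x y = ρ := by
    rw [hy, dist_left_midpoint]
    simp [hρ]
    ring
  have hyp : dist y p = ρ := by
    rw [hy, dist_midpoint_right]
    simp [hρ]
    ring
  have hin : ∀ s, dist s y ≤ ρ → s ≠ p → f s < f x₀ := by
    intro s hs hsp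
    refine lt_of_le_of_ne (hmax s) fun hsZ => hsp ?_
    have h1 : dist x p ≤ dist x s := hp ▸ Metric.infDist_le_dist_of_mem hsZ
    have h2 : dist x s ≤ dist x y + dist y s := dist_triangle _ _ _
    rw [dist_comm s y] at hs
    have h3 : dist x s = 2 * ρ := by
      apply le_antisymm <;> linarith
    have h4 : y = midpoint ℝ x s := eq_midpoint_of_dist_eq_half (by linarith) (by linarith)
    rw [hy] at h4
    exact ((AffineEquiv.pointReflection_midpoint_left (R := ℝ) x p).symm.trans
      (h4 ▸ AffineEquiv.pointReflection_midpoint_left (R := ℝ) x s)).symm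
  have hK : IsCompact (Metric.closedBall p (ρ / 2)) := isCompact_closedBall _ _
  have hKy : ∀ s ∈ Metric.closedBall p (ρ / 2), s ≠ y := by
    rintro s hs rfl
    rw [Metric.mem_closedBall, hyp] at hs
    linarith
  set q : EuclideanSpace ℝ (Fin n) → ℝ := fun z => ‖z - y‖ ^ 2 with hq
  have hqs : ContDiff ℝ ∞ q := contDiff_normSq_sub y
  have hqpos : ∀ s ∈ Metric.closedBall p (ρ / 2), 0 < gradSq a q s := fun s hs =>
    gradSq_normSq_sub_pos (hpd s) (hKy s hs)
  -- `L e^{-αq} = e^{-αq}(α²|∇q|² - α L q)` is positive once `α` exceeds `L q / |∇q|²`. This ratio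
  -- is bounded on the small ball around `p`, which avoids the only zero `y` of `∇q`.
  obtain ⟨C, hC⟩ := hK.bddAbove_image (f := fun s => driftOp a q s / gradSq a q s)
    ((continuous_driftOp hac hqs).continuousOn.div (continuous_gradSq hac hqs).continuousOn
      fun s hs => (hqpos s hs).ne')
  set α := |C| + 1 with hα
  have hα0 : 0 < α := by positivity
  have hbar : ∀ s ∈ Metric.closedBall p (ρ / 2),
      0 < driftOp a (fun z => Real.exp (-α * q z)) s := by
    intro s hs
    rw [driftOp_exp hqs]
    have h1 : driftOp a q s / gradSq a q s ≤ C := hC ⟨s, hs, rfl⟩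
    rw [div_le_iff₀ (hqpos s hs)] at h1
    have h2 : C < α := by
      have := le_abs_self C
      linarith
    have h3 : driftOp a q s < α * gradSq a q s :=
      h1.trans_lt (mul_lt_mul_of_pos_right h2 (hqpos s hs))
    have h4 : 0 < α * (α * gradSq a q s - driftOp a q s) := mul_pos hα0 (by linarith)
    refine mul_pos (Real.exp_pos _) ?_
    linarith
  obtain ⟨δ, hδ, hS⟩ : ∃ δ > 0, ∀ s ∈ Metric.sphere p (ρ / 2) ∩ Metric.closedBall y ρ,
      f s ≤ f x₀ - δ := by
    rcases (Metric.sphere p (ρ / 2) ∩ Metric.closedBall y ρ).eq_empty_or_nonempty with he | hne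
    · exact ⟨1, one_pos, by simp [he]⟩
    · obtain ⟨s, hs, hsmax⟩ := ((isCompact_sphere p (ρ / 2)).inter_right
        Metric.isClosed_closedBall).exists_isMaxOn hne hf.continuous.continuousOn
      have hsp : s ≠ p := by
        rintro rfl
        have := hs.1
        rw [Metric.mem_sphere, dist_self] at this
        linarith
      exact ⟨f x₀ - f s, sub_pos.2 (hin s hs.2 hsp), fun t ht => by
        have := hsmax ht
        simp only [Set.mem_ofPred_eq] at this
        linarith⟩
  have hEs : ContDiff ℝ ∞ fun z => Real.exp (-α * q z) := (contDiff_const.mul hqs).exp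
  -- The perturbation is strictly `L`-subharmonic near `p`, and no value on the small sphere exceeds
  -- `F p`: inside the ball about `y` the gap `δ` pays for the barrier, outside it the barrier is
  -- below its value at `p`. So `F` has an interior maximum, where `L F ≤ 0`.
  set F : EuclideanSpace ℝ (Fin n) → ℝ := fun z => f z + δ * Real.exp (-α * q z) with hF
  have hFs : ContDiff ℝ ∞ F := hf.add (contDiff_const.mul hEs)
  have hLF : ∀ s ∈ Metric.closedBall p (ρ / 2), 0 < driftOp a F s := by
    intro s hs
    rw [hF, driftOp_add hf (contDiff_const.mul hEs), driftOp_const_mul hEs]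
    have := mul_pos hδ (hbar s hs)
    linarith [hL s]
  have hFp : F p = f x₀ + δ * Real.exp (-α * ρ ^ 2) := by
    have h1 : q p = ρ ^ 2 := by
      rw [hq, ← hyp, dist_comm, dist_eq_norm]
    have h2 : f p = f x₀ := hpZ
    simp only [hF, h1, h2]
  have hsph : ∀ s ∈ Metric.sphere p (ρ / 2), F s ≤ F p := by
    intro s hs
    rw [hFp]
    rcases le_total (dist s y) ρ with h | h
    · have h1 := hS s ⟨hs, h⟩
      have h2 : Real.exp (-α * q s) ≤ 1 := by
        rw [Real.exp_le_one_iff]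
        have : 0 ≤ α * q s := by positivity
        linarith
      have h3 : 0 ≤ δ * Real.exp (-α * ρ ^ 2) := by positivity
      have h4 := mul_le_mul_of_nonneg_left h2 hδ.le
      simp only [hF]
      linarith
    · have h1 : ρ ^ 2 ≤ q s := by
        rw [dist_eq_norm] at h
        exact pow_le_pow_left₀ hρ0.le h 2
      have h2 : Real.exp (-α * q s) ≤ Real.exp (-α * ρ ^ 2) := by
        rw [Real.exp_le_exp]
        have := mul_le_mul_of_nonneg_left h1 hα0.le
        linarith
      exact add_le_add (hmax s) (mul_le_mul_of_nonneg_left h2 hδ.le)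
  obtain ⟨s, hs, hsmax⟩ := hK.exists_isMaxOn ⟨p, Metric.mem_closedBall_self (by positivity)⟩
    hFs.continuous.continuousOn
  obtain ⟨t, ht, htmax⟩ : ∃ t ∈ Metric.ball p (ρ / 2),
      IsMaxOn F (Metric.closedBall p (ρ / 2)) t := by
    by_cases hsb : s ∈ Metric.ball p (ρ / 2)
    · exact ⟨s, hsb, hsmax⟩
    · have hss : s ∈ Metric.sphere p (ρ / 2) := by
        rw [Metric.mem_sphere]
        rw [Metric.mem_ball] at hsb
        exact le_antisymm hs (not_lt.1 hsb)
      exact ⟨p, Metric.mem_ball_self (by positivity), fun z hz => (hsmax hz).trans (hsph s hss)⟩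
  have hloc : IsLocalMax F t :=
    htmax.isLocalMax (Filter.mem_of_superset (Metric.isOpen_ball.mem_nhds ht)
      Metric.ball_subset_closedBall)
  have h1 := driftOp_nonpos_of_isLocalMax hFs (hpd t).posSemidef hloc
  have h2 := hLF t (Metric.ball_subset_closedBall ht)
  linarith

/-- A bounded above subsolution of the drift operator attains its maximum, because
`n - |x|²` controls the operator on `|x|²`. -/
theorem exists_forall_le_of_driftOp_nonneg (hpd : ∀ x, (a x).PosSemidef)
    (htr : ∀ x, (a x).trace ≤ n) {f : EuclideanSpace ℝ (Fin n) → ℝ} (hf : ContDiff ℝ ∞ f)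
    (hL : ∀ x, 0 ≤ driftOp a f x) {C : ℝ} (hC : ∀ x, f x ≤ C) : ∃ x₀, ∀ x, f x ≤ f x₀ := by
  obtain ⟨x₀, -, hx₀⟩ := (isCompact_closedBall (0 : EuclideanSpace ℝ (Fin n)) √n).exists_isMaxOn
    ⟨0, Metric.mem_closedBall_self (by positivity)⟩ hf.continuous.continuousOn
  refine ⟨x₀, fun x => ?_⟩
  have hns : ContDiff ℝ ∞ fun z : EuclideanSpace ℝ (Fin n) => ‖z‖ ^ 2 := contDiff_id.norm_sq ℝ
  -- The penalty `-ε|z|²` forces a maximum point `x₁`. There `L ≤ 0` gives `|x₁|² ≤ tr a ≤ n`, so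
  -- `x₁` lies in the ball on which `x₀` is maximal; finally `ε → 0`.
  have key : ∀ ε > 0, f x ≤ f x₀ + ε * ‖x‖ ^ 2 := by
    intro ε hε
    set ψ : EuclideanSpace ℝ (Fin n) → ℝ := fun z => f z + (-ε) * ‖z‖ ^ 2 with hψ
    have hψs : ContDiff ℝ ∞ ψ := hf.add (contDiff_const.mul hns)
    have hlim : Filter.Tendsto ψ (Filter.cocompact _) Filter.atBot := by
      refine Filter.tendsto_atBot_mono (fun z => add_le_add_left (hC z) _) ?_
      refine Filter.tendsto_atBot_add_const_left _ _ ?_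
      refine Filter.Tendsto.const_mul_atTop_of_neg (by linarith) ?_
      exact (Filter.tendsto_pow_atTop (by norm_num)).comp tendsto_norm_cocompact_atTop
    obtain ⟨x₁, hx₁⟩ := hψs.continuous.exists_forall_ge hlim
    have h1 := driftOp_nonpos_of_isLocalMax hψs (hpd x₁) (Filter.Eventually.of_forall hx₁)
    rw [hψ, driftOp_add hf (contDiff_const.mul hns), driftOp_const_mul hns, driftOp_normSq] at h1
    have h2 : ‖x₁‖ ^ 2 ≤ n := by
      by_contra hcon
      push Not at hcon
      have h3 : 0 < ε * (‖x₁‖ ^ 2 - (a x₁).trace) := mul_pos hε (by linarith [htr x₁])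
      linarith [hL x₁]
    have h4 : f x₁ ≤ f x₀ := hx₀ (by
      rw [mem_closedBall_zero_iff]
      exact Real.le_sqrt_of_sq_le h2)
    have h5 := hx₁ x
    simp only [hψ] at h5
    have h6 : 0 ≤ ε * ‖x₁‖ ^ 2 := by positivity
    linarith
  refine le_of_forall_pos_le_add fun η hη => ?_
  refine (key (η / (‖x‖ ^ 2 + 1)) (by positivity)).trans ?_
  gcongr
  rw [div_mul_eq_mul_div, div_le_iff₀ (by positivity)]
  nlinarith

/-- If `L f + t |∇f|² ≥ 0` and `t⁻¹ e^{t f}` is bounded above, then `f` is constant. -/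
theorem eq_of_driftOp_add_gradSq_nonneg (hac : ∀ i j, Continuous fun x => a x i j)
    (hpd : ∀ x, (a x).PosDef) (htr : ∀ x, (a x).trace ≤ n)
    {f : EuclideanSpace ℝ (Fin n) → ℝ} (hf : ContDiff ℝ ∞ f) {t : ℝ} (ht : t ≠ 0)
    (hL : ∀ x, 0 ≤ driftOp a f x + t * gradSq a f x) {C : ℝ}
    (hC : ∀ x, t⁻¹ * Real.exp (t * f x) ≤ C) (x y : EuclideanSpace ℝ (Fin n)) : f x = f y := by
  have hes : ContDiff ℝ ∞ fun x => Real.exp (t * f x) := (contDiff_const.mul hf).exp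
  have hφs : ContDiff ℝ ∞ fun x => t⁻¹ * Real.exp (t * f x) := contDiff_const.mul hes
  have hφL : ∀ x, 0 ≤ driftOp a (fun x => t⁻¹ * Real.exp (t * f x)) x := by
    intro x
    rw [driftOp_const_mul hes, driftOp_exp hf]
    have : t⁻¹ * (Real.exp (t * f x) * (t * driftOp a f x + t ^ 2 * gradSq a f x)) =
        Real.exp (t * f x) * (driftOp a f x + t * gradSq a f x) := by
      field_simp
    rw [this]
    exact mul_nonneg (Real.exp_pos _).le (hL x)
  obtain ⟨x₀, hx₀⟩ := exists_forall_le_of_driftOp_nonneg (fun x => (hpd x).posSemidef) htr hφs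
    hφL hC
  have key : ∀ x, f x = f x₀ := by
    intro x
    have h := eq_of_driftOp_nonneg_of_forall_le hac hpd hφs hφL hx₀ x
    have h' := mul_left_cancel₀ (inv_ne_zero ht) h
    exact mul_left_cancel₀ ht (Real.exp_injective h')
  rw [key x, key y]

/-! ### Derivatives of determinants, of the induced metric and of its volume element. -/

theorem partialDeriv_prod {ι : Type*} [DecidableEq ι] {s : Finset ι}
    {f : ι → EuclideanSpace ℝ (Fin n) → ℝ}
    (hf : ∀ i, Differentiable ℝ (f i)) (k : Fin n) (x : EuclideanSpace ℝ (Fin n)) :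
    partialDeriv (fun y => ∏ i ∈ s, f i y) k x =
      ∑ i ∈ s, (∏ j ∈ s.erase i, f j x) * partialDeriv (f i) k x := by
  rw [partialDeriv_of_hasFDerivAt (HasFDerivAt.finsetProd fun i _ => (hf i x).hasFDerivAt)]
  simp [partialDeriv]

theorem contDiff_det {ι : Type*} [Fintype ι] [DecidableEq ι]
    {M : EuclideanSpace ℝ (Fin n) → Matrix ι ι ℝ}
    (hM : ∀ i j, ContDiff ℝ ∞ fun x => M x i j) : ContDiff ℝ ∞ fun x => (M x).det := by
  simp only [Matrix.det_apply']
  exact ContDiff.sum fun σ _ => contDiff_const.mul (contDiff_prod fun i _ => hM _ _)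

/-- Jacobi's formula for the derivative of a determinant. -/
theorem partialDeriv_det {ι : Type*} [Fintype ι] [DecidableEq ι]
    {M : EuclideanSpace ℝ (Fin n) → Matrix ι ι ℝ}
    (hM : ∀ i j, ContDiff ℝ ∞ fun x => M x i j) (k : Fin n) (x : EuclideanSpace ℝ (Fin n)) :
    partialDeriv (fun y => (M y).det) k x =
      ∑ i, ∑ j, (M x).adjugate i j * partialDeriv (fun y => M y j i) k x := by
  have hd : ∀ i j, Differentiable ℝ fun x => M x i j := fun i j =>
    contDiff_smooth_differentiable (hM i j)
  have hprod : ∀ σ : Equiv.Perm ι, Differentiable ℝ fun y => ∏ i, M y (σ i) i := fun σ =>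
    contDiff_smooth_differentiable (contDiff_prod fun i _ => hM _ _)
  -- By Cramer's rule each summand is the determinant with one column differentiated, which is the
  -- product rule applied to every permutation term.
  have h1 : ∀ i, ∑ j, (M x).adjugate i j * partialDeriv (fun y => M y j i) k x =
      ((M x).updateCol i fun j => partialDeriv (fun y => M y j i) k x).det := by
    intro i
    rw [← Matrix.cramer_apply, Matrix.cramer_eq_adjugate_mulVec]
    rfl
  simp only [h1, Matrix.det_apply']
  rw [partialDeriv_sum fun σ => (hprod σ).const_mul _]
  simp only
  rw [Finset.sum_comm]
  refine Finset.sum_congr rfl fun σ _ => ?_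
  rw [partialDeriv_const_mul (hprod σ)]
  simp only
  rw [partialDeriv_prod fun i => hd _ _, ← Finset.mul_sum]
  congr 1
  refine Finset.sum_congr rfl fun i _ => ?_
  rw [← Finset.mul_prod_erase _ _ (Finset.mem_univ i), mul_comm]
  simp only [Matrix.updateCol_self]
  congr 1
  refine Finset.prod_congr rfl fun j hj => ?_
  rw [Matrix.updateCol_ne (Finset.ne_of_mem_erase hj)]

variable {u : EuclideanSpace ℝ (Fin n) → EuclideanSpace ℝ (Fin m)}

theorem contDiff_coord_comp (hu : ContDiff ℝ ∞ u) (α : Fin m) :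
    ContDiff ℝ ∞ fun y => u y α := by
  fun_prop

theorem contDiff_d1 (hu : ContDiff ℝ ∞ u) (α : Fin m) (i : Fin n) : ContDiff ℝ ∞ (d1 u α i) :=
  contDiff_partialDeriv (contDiff_coord_comp hu α) i

theorem contDiff_d2 (hu : ContDiff ℝ ∞ u) (α : Fin m) (i j : Fin n) :
    ContDiff ℝ ∞ (d2 u α i j) :=
  contDiff_partialDeriv (contDiff_d1 hu α i) j

theorem d2_comm (hu : ContDiff ℝ ∞ u) (α : Fin m) (i j : Fin n) : d2 u α i j = d2 u α j i :=
  funext fun x => partialDeriv_comm (contDiff_coord_comp hu α) i j x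

theorem partialDeriv_d1 (α : Fin m) (i j : Fin n) : partialDeriv (d1 u α i) j = d2 u α i j := rfl

theorem partialDeriv_d2_comm (hu : ContDiff ℝ ∞ u) (α : Fin m) (i j k : Fin n) :
    partialDeriv (d2 u α i j) k = partialDeriv (d2 u α i k) j :=
  funext fun x => partialDeriv_comm (contDiff_d1 hu α i) j k x

theorem contDiff_inducedMetric (hu : ContDiff ℝ ∞ u) (i j : Fin n) :
    ContDiff ℝ ∞ fun x => inducedMetric u x i j := by
  simp only [inducedMetric, Matrix.of_apply]
  exact contDiff_const.add (ContDiff.sum fun α _ => (contDiff_d1 hu α i).mul (contDiff_d1 hu α j))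

/-- The contraction `∑_α u^α_i u^α_{jk}`. -/
def gradHess (u : EuclideanSpace ℝ (Fin n) → EuclideanSpace ℝ (Fin m))
    (x : EuclideanSpace ℝ (Fin n)) (i j k : Fin n) : ℝ :=
  ∑ α, d1 u α i x * d2 u α j k x

theorem partialDeriv_inducedMetric (hu : ContDiff ℝ ∞ u) (i j k : Fin n) :
    partialDeriv (fun y => inducedMetric u y i j) k =
      fun x => gradHess u x i j k + gradHess u x j i k := by
  have hd : ∀ α i, Differentiable ℝ (d1 u α i) := fun α i =>
    contDiff_smooth_differentiable (contDiff_d1 hu α i)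
  simp only [inducedMetric, Matrix.of_apply]
  rw [partialDeriv_add (by fun_prop) (by fun_prop), partialDeriv_const,
    partialDeriv_sum fun α => (hd α i).fun_mul (hd α j)]
  ext x
  simp only [gradHess, zero_add, ← Finset.sum_add_distrib]
  refine Finset.sum_congr rfl fun α _ => ?_
  rw [partialDeriv_mul (hd α i) (hd α j), partialDeriv_d1, partialDeriv_d1]
  ring

theorem inducedMetric_det_pos (u : EuclideanSpace ℝ (Fin n) → EuclideanSpace ℝ (Fin m))
    (x : EuclideanSpace ℝ (Fin n)) : 0 < (inducedMetric u x).det :=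
  (inducedMetric_posDef u x).det_pos

theorem inducedMetric_isUnit (u : EuclideanSpace ℝ (Fin n) → EuclideanSpace ℝ (Fin m))
    (x : EuclideanSpace ℝ (Fin n)) : IsUnit (inducedMetric u x).det :=
  (inducedMetric_det_pos u x).ne'.isUnit

theorem inverseMetric_apply (x : EuclideanSpace ℝ (Fin n)) (i j : Fin n) :
    inverseMetric u x i j = (inducedMetric u x).det⁻¹ * (inducedMetric u x).adjugate i j := by
  simp [inverseMetric, Matrix.inv_def]

theorem inverseMetric_posDef (u : EuclideanSpace ℝ (Fin n) → EuclideanSpace ℝ (Fin m))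
    (x : EuclideanSpace ℝ (Fin n)) : (inverseMetric u x).PosDef :=
  (inducedMetric_posDef u x).inv

theorem inverseMetric_comm (u : EuclideanSpace ℝ (Fin n) → EuclideanSpace ℝ (Fin m))
    (x : EuclideanSpace ℝ (Fin n)) (i j : Fin n) :
    inverseMetric u x i j = inverseMetric u x j i := by
  simpa using (inverseMetric_posDef u x).isHermitian.apply j i

theorem contDiff_inverseMetric (hu : ContDiff ℝ ∞ u) (i j : Fin n) :
    ContDiff ℝ ∞ fun x => inverseMetric u x i j := by
  simp only [inverseMetric_apply, Matrix.adjugate_apply]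
  refine ((contDiff_det (contDiff_inducedMetric hu)).inv fun x =>
    (inducedMetric_det_pos u x).ne').mul (contDiff_det fun k l => ?_)
  simp only [Matrix.updateRow_apply]
  split_ifs
  · exact contDiff_const
  · exact contDiff_inducedMetric hu k l

/-- Differentiating `g⁻¹ g = 1` gives `∂g⁻¹ = -g⁻¹ (∂g) g⁻¹`. -/
theorem partialDeriv_inverseMetric (hu : ContDiff ℝ ∞ u) (k i j : Fin n)
    (x : EuclideanSpace ℝ (Fin n)) :
    partialDeriv (fun y => inverseMetric u y i j) k x =
      -∑ a, ∑ b, inverseMetric u x i a * (gradHess u x a b k + gradHess u x b a k) *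
        inverseMetric u x b j := by
  have hG : ∀ i j, Differentiable ℝ fun y => inverseMetric u y i j := fun i j =>
    contDiff_smooth_differentiable (contDiff_inverseMetric hu i j)
  have hg : ∀ i j, Differentiable ℝ fun y => inducedMetric u y i j := fun i j =>
    contDiff_smooth_differentiable (contDiff_inducedMetric hu i j)
  set G' : Matrix (Fin n) (Fin n) ℝ :=
    Matrix.of fun i j => partialDeriv (fun y => inverseMetric u y i j) k x with hG'
  set g' : Matrix (Fin n) (Fin n) ℝ :=
    Matrix.of fun i j => gradHess u x i j k + gradHess u x j i k with hg'
  have h1 : G' * inducedMetric u x + inverseMetric u x * g' = 0 := by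
    ext a b
    have h2 : (fun y => ∑ l, inverseMetric u y a l * inducedMetric u y l b) =
        fun _ => (1 : Matrix (Fin n) (Fin n) ℝ) a b := by
      ext y
      rw [← Matrix.mul_apply, inverseMetric,
        Matrix.nonsing_inv_mul _ (inducedMetric_isUnit u y)]
    have h3 := congrFun (congrArg (fun f => partialDeriv f k) h2) x
    simp only [partialDeriv_const] at h3
    rw [partialDeriv_sum fun l => (hG a l).fun_mul (hg l b)] at h3
    simp only [partialDeriv_mul (hG _ _) (hg _ _), partialDeriv_inducedMetric hu] at h3
    simp only [Matrix.add_apply, Matrix.mul_apply, hG', hg', Matrix.of_apply, Matrix.zero_apply,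
      ← Finset.sum_add_distrib]
    exact h3
  have h4 : G' = -(inverseMetric u x * g' * inverseMetric u x) := by
    have h5 : G' * inducedMetric u x * inverseMetric u x = G' := by
      rw [Matrix.mul_assoc, inverseMetric, Matrix.mul_nonsing_inv _ (inducedMetric_isUnit u x),
        Matrix.mul_one]
    rw [← h5, eq_neg_of_add_eq_zero_left h1, Matrix.neg_mul]
  have h6 := congrFun (congrFun h4 i) j
  rw [hG', Matrix.of_apply] at h6
  rw [h6, Matrix.neg_apply, Matrix.mul_apply]
  simp only [Matrix.mul_apply, Finset.sum_mul, hg', Matrix.of_apply]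
  rw [Finset.sum_comm]

/-- The logarithm of the volume element `√(det g)`. -/
def logVolume (u : EuclideanSpace ℝ (Fin n) → EuclideanSpace ℝ (Fin m))
    (x : EuclideanSpace ℝ (Fin n)) : ℝ :=
  1 / 2 * Real.log (inducedMetric u x).det

theorem contDiff_logVolume (hu : ContDiff ℝ ∞ u) : ContDiff ℝ ∞ (logVolume u) :=
  contDiff_const.mul ((contDiff_det (contDiff_inducedMetric hu)).log fun x =>
    (inducedMetric_det_pos u x).ne')

theorem partialDeriv_logVolume (hu : ContDiff ℝ ∞ u) (k : Fin n) :
    partialDeriv (logVolume u) k =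
      fun x => ∑ i, ∑ j, inverseMetric u x i j * gradHess u x i j k := by
  have hdet : Differentiable ℝ fun y => (inducedMetric u y).det :=
    contDiff_smooth_differentiable (contDiff_det (contDiff_inducedMetric hu))
  have h0 : ∀ y, (inducedMetric u y).det ≠ 0 := fun y => (inducedMetric_det_pos u y).ne'
  ext x
  have h1 : partialDeriv (logVolume u) k x =
      1 / 2 * ((inducedMetric u x).det⁻¹ *
        partialDeriv (fun y => (inducedMetric u y).det) k x) := by
    have h2 := partialDeriv_comp (g := fun s => 1 / 2 * Real.log s) (g' := fun s => 1 / 2 * s⁻¹)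
      hdet (fun y => (Real.hasDerivAt_log (h0 y)).const_mul _) k
    rw [← mul_assoc]
    exact congrFun h2 x
  rw [h1, partialDeriv_det (contDiff_inducedMetric hu), Finset.mul_sum]
  simp only [Finset.mul_sum, partialDeriv_inducedMetric hu]
  have h3 : ∑ i, ∑ j, inverseMetric u x i j * gradHess u x j i k =
      ∑ i, ∑ j, inverseMetric u x i j * gradHess u x i j k := by
    rw [Finset.sum_comm]
    exact Finset.sum_congr rfl fun i _ => Finset.sum_congr rfl fun j _ => by
      rw [inverseMetric_comm]
  calc _ = ∑ i, ∑ j, (1 / 2 * (inverseMetric u x i j * gradHess u x j i k) +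
        1 / 2 * (inverseMetric u x i j * gradHess u x i j k)) :=
        Finset.sum_congr rfl fun i _ => Finset.sum_congr rfl fun j _ => by
          rw [inverseMetric_apply]
          ring
    _ = _ := by
        simp only [Finset.sum_add_distrib, ← Finset.mul_sum]
        rw [h3]
        ring

/-! ### The drift operator applied to the logarithm of the volume element. -/

/-- The contraction of two `2`-tensors by a bilinear form. -/
def contract₂ (G : Matrix (Fin n) (Fin n) ℝ) (X Y : Fin n → Fin n → ℝ) : ℝ :=
  ∑ k, ∑ l, G k l * ∑ i, ∑ j, G i j * (X i l * Y j k)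

/-- The contraction of two `3`-tensors by a bilinear form. -/
def contract₃ (G : Matrix (Fin n) (Fin n) ℝ) (X Y : Fin n → Fin n → Fin n → ℝ) : ℝ :=
  ∑ k, ∑ l, G k l * ∑ i, ∑ a, G i a * ∑ j, ∑ b, G j b * (X i j k * Y a b l)

theorem partialDeriv_gradHess (hu : ContDiff ℝ ∞ u) (i j k l : Fin n) :
    partialDeriv (fun x => gradHess u x i j k) l =
      fun x => ∑ α, d2 u α i l x * d2 u α j k x +
        ∑ α, d1 u α i x * partialDeriv (d2 u α j k) l x := by
  have hd1 : ∀ α i, Differentiable ℝ (d1 u α i) := fun α i =>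
    contDiff_smooth_differentiable (contDiff_d1 hu α i)
  have hd2 : ∀ α i j, Differentiable ℝ (d2 u α i j) := fun α i j =>
    contDiff_smooth_differentiable (contDiff_d2 hu α i j)
  simp only [gradHess]
  rw [partialDeriv_sum fun α => (hd1 α i).fun_mul (hd2 α j k)]
  ext x
  rw [← Finset.sum_add_distrib]
  refine Finset.sum_congr rfl fun α _ => ?_
  rw [partialDeriv_mul (hd1 α i) (hd2 α j k), partialDeriv_d1]

/-- The derivative of the self-shrinker system in the direction `xⱼ`. -/
theorem shrinker_derivative (hu : ContDiff ℝ ∞ u) (hs : IsSelfShrinkerSolution u) (α : Fin m)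
    (j : Fin n) (x : EuclideanSpace ℝ (Fin n)) :
    ∑ k, ∑ l, inverseMetric u x k l * partialDeriv (d2 u α j k) l x -
      ∑ k, x k * d2 u α j k x =
    ∑ k, ∑ l, (∑ a, ∑ b, inverseMetric u x k a * (gradHess u x a b j + gradHess u x b a j) *
        inverseMetric u x b l) * d2 u α k l x := by
  have hG : ∀ i j, Differentiable ℝ fun y => inverseMetric u y i j := fun i j =>
    contDiff_smooth_differentiable (contDiff_inverseMetric hu i j)
  have hd0 : Differentiable ℝ fun y => u y α :=
    contDiff_smooth_differentiable (contDiff_coord_comp hu α)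
  have hd1 : ∀ i, Differentiable ℝ (d1 u α i) := fun i =>
    contDiff_smooth_differentiable (contDiff_d1 hu α i)
  have hd2 : ∀ i j, Differentiable ℝ (d2 u α i j) := fun i j =>
    contDiff_smooth_differentiable (contDiff_d2 hu α i j)
  have hx : ∀ i, Differentiable ℝ fun y : EuclideanSpace ℝ (Fin n) => y i := fun i => by fun_prop
  have h := congrFun (congrArg (fun f => partialDeriv f j)
    (funext fun y => hs y α)) x
  simp only at h
  rw [partialDeriv_sum fun k => Differentiable.fun_sum fun l _ => (hG k l).fun_mul (hd2 k l),
    partialDeriv_add hd0.fun_neg (Differentiable.fun_sum fun i _ => (hx i).fun_mul (hd1 i)),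
    partialDeriv_neg, partialDeriv_sum fun i => (hx i).fun_mul (hd1 i)] at h
  simp only [partialDeriv_sum fun l => (hG _ l).fun_mul (hd2 _ l),
    partialDeriv_mul (hG _ _) (hd2 _ _), partialDeriv_mul (hx _) (hd1 _), partialDeriv_coord,
    partialDeriv_inverseMetric hu, partialDeriv_d1] at h
  have hV : ∀ k l, partialDeriv (d2 u α k l) j = partialDeriv (d2 u α j k) l := fun k l => by
    rw [partialDeriv_d2_comm hu, d2_comm hu]
  have h5 : partialDeriv (fun y => u y α) j x = d1 u α j x := rfl
  -- The Kronecker delta from `∂ⱼxᵢ` produces `u^α_j`, which cancels the derivative of `-u^α`.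
  simp only [hV, Finset.sum_add_distrib, neg_mul, Finset.sum_neg_distrib, ite_mul, one_mul,
    zero_mul, Finset.sum_ite_eq, Finset.mem_univ, if_true, h5] at h
  have h6 : ∑ k, x k * d2 u α j k x = ∑ k, x k * d2 u α k j x :=
    Finset.sum_congr rfl fun k _ => by rw [d2_comm hu]
  linarith

theorem sum_sum_comm {ι κ : Type*} [Fintype ι] [Fintype κ] (f : ι → ι → κ → κ → ℝ) :
    ∑ i, ∑ j, ∑ k, ∑ l, f i j k l = ∑ k, ∑ l, ∑ i, ∑ j, f i j k l := by
  calc _ = ∑ i, ∑ k, ∑ j, ∑ l, f i j k l := Finset.sum_congr rfl fun i _ => Finset.sum_comm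
    _ = ∑ k, ∑ i, ∑ l, ∑ j, f i j k l := by
        rw [Finset.sum_comm]
        exact Finset.sum_congr rfl fun k _ => Finset.sum_congr rfl fun i _ => Finset.sum_comm
    _ = _ := Finset.sum_congr rfl fun k _ => Finset.sum_comm

theorem contract₃_eq {G : Matrix (Fin n) (Fin n) ℝ} (hG : ∀ i j, G i j = G j i)
    (X Y : Fin n → Fin n → Fin n → ℝ) :
    contract₃ G X Y =
      ∑ k, ∑ l, G k l * ∑ i, ∑ j, (∑ a, ∑ b, G i a * Y a b l * G b j) * X i j k := by
  refine Finset.sum_congr rfl fun k _ => Finset.sum_congr rfl fun l _ => ?_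
  congr 1
  refine Finset.sum_congr rfl fun i _ => ?_
  simp only [Finset.sum_mul, Finset.mul_sum]
  rw [Finset.sum_comm]
  refine Finset.sum_congr rfl fun j _ => Finset.sum_congr rfl fun a _ =>
    Finset.sum_congr rfl fun b _ => ?_
  rw [hG j b]
  ring

/-- `∂_k f = g^{ij} u_i·u_{jk}`, so `∂_l∂_k f` has three parts. The derivative falling on `g^{ij}`
gives the negative term, and on `u_i` the square of the Hessian. The third derivatives `u_{jkl}`
combine with the drift into `L u_j`, which `shrinker_derivative` expresses through second
derivatives. -/
theorem driftOp_logVolume (hu : ContDiff ℝ ∞ u) (hs : IsSelfShrinkerSolution u)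
    (x : EuclideanSpace ℝ (Fin n)) :
    driftOp (inverseMetric u) (logVolume u) x =
      ∑ α, contract₂ (inverseMetric u x) (fun i j => d2 u α i j x) (fun i j => d2 u α i j x) -
      contract₃ (inverseMetric u x) (gradHess u x)
        (fun a b l => gradHess u x a b l + gradHess u x b a l) +
      contract₃ (inverseMetric u x) (fun i j k => gradHess u x k i j)
        (fun a b l => gradHess u x a b l + gradHess u x b a l) := by
  have hG : ∀ i j, Differentiable ℝ fun y => inverseMetric u y i j := fun i j =>
    contDiff_smooth_differentiable (contDiff_inverseMetric hu i j)
  have hc : ∀ i j k, Differentiable ℝ fun y => gradHess u y i j k := fun i j k =>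
    Differentiable.fun_sum fun α _ =>
      (contDiff_smooth_differentiable (contDiff_d1 hu α i)).fun_mul
        (contDiff_smooth_differentiable (contDiff_d2 hu α j k))
  have h2 : ∀ k l, partialDeriv
      (fun y => ∑ i, ∑ j, inverseMetric u y i j * gradHess u y i j k) l x =
      -(∑ i, ∑ j, (∑ a, ∑ b, inverseMetric u x i a *
        (gradHess u x a b l + gradHess u x b a l) * inverseMetric u x b j) * gradHess u x i j k) +
      (∑ i, ∑ j, inverseMetric u x i j * ∑ α, d2 u α i l x * d2 u α j k x +
      ∑ i, ∑ j, inverseMetric u x i j * ∑ α, d1 u α i x * partialDeriv (d2 u α j k) l x) := by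
    intro k l
    rw [partialDeriv_sum fun i => Differentiable.fun_sum fun j _ => (hG i j).fun_mul (hc i j k)]
    simp only [partialDeriv_sum fun j => (hG _ j).fun_mul (hc _ j k),
      partialDeriv_mul (hG _ _) (hc _ _ _), partialDeriv_inverseMetric hu,
      partialDeriv_gradHess hu]
    simp only [Finset.sum_add_distrib, neg_mul, Finset.sum_neg_distrib, mul_add]
  have h3 : ∑ k, ∑ l, inverseMetric u x k l * ∑ i, ∑ j, inverseMetric u x i j *
        ∑ α, d1 u α i x * partialDeriv (d2 u α j k) l x -
      ∑ k, x k * ∑ i, ∑ j, inverseMetric u x i j * gradHess u x i j k =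
      contract₃ (inverseMetric u x) (fun i j k => gradHess u x k i j)
        (fun a b l => gradHess u x a b l + gradHess u x b a l) := by
    have h4 : ∑ i, ∑ j, inverseMetric u x i j * ∑ α, d1 u α i x *
        (∑ k, ∑ l, inverseMetric u x k l * partialDeriv (d2 u α j k) l x -
          ∑ k, x k * d2 u α j k x) = contract₃ (inverseMetric u x)
          (fun i j k => gradHess u x k i j)
          (fun a b l => gradHess u x a b l + gradHess u x b a l) := by
      simp only [shrinker_derivative hu hs]
      rw [contract₃_eq (inverseMetric_comm u x)]
      refine Finset.sum_congr rfl fun k _ => Finset.sum_congr rfl fun l _ => ?_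
      congr 1
      simp only [gradHess, Finset.mul_sum (s := Finset.univ (α := Fin n))]
      rw [Finset.sum_comm]
      refine Finset.sum_congr rfl fun i _ => ?_
      rw [Finset.sum_comm]
      refine Finset.sum_congr rfl fun j _ => ?_
      rw [Finset.mul_sum]
      exact Finset.sum_congr rfl fun α _ => by ring
    rw [← h4]
    simp only [mul_sub, Finset.sum_sub_distrib]
    congr 1
    · simp only [Finset.mul_sum]
      rw [sum_sum_comm]
      refine Finset.sum_congr rfl fun i _ => Finset.sum_congr rfl fun j _ => ?_
      calc _ = ∑ k, ∑ α, ∑ l, inverseMetric u x k l * (inverseMetric u x i j *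
            (d1 u α i x * partialDeriv (d2 u α j k) l x)) :=
            Finset.sum_congr rfl fun k _ => Finset.sum_comm
        _ = _ := by
            rw [Finset.sum_comm]
            exact Finset.sum_congr rfl fun α _ => Finset.sum_congr rfl fun k _ =>
              Finset.sum_congr rfl fun l _ => by ring
    · simp only [Finset.mul_sum, gradHess]
      rw [Finset.sum_comm]
      refine Finset.sum_congr rfl fun i _ => ?_
      rw [Finset.sum_comm]
      refine Finset.sum_congr rfl fun j _ => ?_
      rw [Finset.sum_comm]
      exact Finset.sum_congr rfl fun α _ => Finset.sum_congr rfl fun k _ => by ring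
  have h5 : ∑ k, ∑ l, inverseMetric u x k l * ∑ i, ∑ j, inverseMetric u x i j *
      ∑ α, d2 u α i l x * d2 u α j k x = ∑ α, contract₂ (inverseMetric u x)
        (fun i j => d2 u α i j x) (fun i j => d2 u α i j x) := by
    simp only [contract₂]
    rw [Finset.sum_comm (γ := Fin m)]
    refine Finset.sum_congr rfl fun k _ => ?_
    rw [Finset.sum_comm (γ := Fin m)]
    refine Finset.sum_congr rfl fun l _ => ?_
    rw [← Finset.mul_sum, Finset.sum_comm (γ := Fin m)]
    congr 1
    refine Finset.sum_congr rfl fun i _ => ?_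
    rw [Finset.sum_comm]
    exact Finset.sum_congr rfl fun j _ => Finset.mul_sum _ _ _
  rw [contract₃_eq (inverseMetric_comm u x) (gradHess u x), ← h3, ← h5]
  simp only [driftOp, partialDeriv_logVolume hu, h2, mul_add, mul_neg, Finset.sum_add_distrib,
    Finset.sum_neg_distrib]
  ring

theorem gradSq_logVolume (hu : ContDiff ℝ ∞ u) (x : EuclideanSpace ℝ (Fin n)) :
    gradSq (inverseMetric u) (logVolume u) x =
      ∑ k, ∑ l, inverseMetric u x k l *
        ((∑ i, ∑ j, inverseMetric u x i j * gradHess u x i j k) *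
          ∑ i, ∑ j, inverseMetric u x i j * gradHess u x i j l) := by
  simp only [gradSq, partialDeriv_logVolume hu]

/-! ### Definiteness of the quadratic form when `λ_i λ_j ≤ 1`. -/

/-- The quadratic form `∑ h_{aik}² + ∑ λ_a λ_i h_{aik} h_{iak}`. -/
def secondFormQuad (lam : Fin n → ℝ) (h : Fin n → Fin n → Fin n → ℝ) : ℝ :=
  ∑ a, ∑ i, ∑ k, (h a i k ^ 2 + lam a * lam i * (h a i k * h i a k))

/-- The trace `∑ λ_i h_{iik}`. -/
def secondFormTrace (lam : Fin n → ℝ) (h : Fin n → Fin n → Fin n → ℝ) (k : Fin n) : ℝ :=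
  ∑ i, lam i * h i i k

theorem eq_zero_of_sum_sq_nonpos {ι : Type*} {s : Finset ι} {f : ι → ℝ}
    (h : ∑ i ∈ s, f i ^ 2 ≤ 0) : ∀ i ∈ s, f i = 0 := fun i hi => by
  have h1 := (Finset.sum_eq_zero_iff_of_nonneg fun i _ => sq_nonneg (f i)).1
    (le_antisymm h (Finset.sum_nonneg fun i _ => sq_nonneg (f i))) i hi
  simpa using h1

/-- A `3`-tensor that is antisymmetric in its first two and symmetric in its last two arguments
vanishes. -/
theorem eq_zero_of_antisymm_of_symm {h : Fin n → Fin n → Fin n → ℝ}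
    (hs : ∀ a i k, h a i k = h a k i) (ha : ∀ a i k, h a i k + h i a k = 0) (a i k : Fin n) :
    h a i k = 0 := by
  have h1 := ha a i k
  have h2 := ha i k a
  have h3 := ha k a i
  rw [hs i a k] at h1
  rw [hs k i a] at h2
  rw [hs a k i] at h3
  linarith

/-- The form dominates a multiple of `∑ (h_{aik} + h_{iak})²`. Its nonpositivity makes `h`
antisymmetric in the first two indices and symmetric in the last two, hence zero. -/
theorem eq_zero_of_pairwise_mul_le_one {lam : Fin n → ℝ} {h : Fin n → Fin n → Fin n → ℝ}
    (hlam : ∀ i, 0 ≤ lam i) (hle : ∀ i j, i ≠ j → lam i * lam j ≤ 1)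
    (hs : ∀ a i k, h a i k = h a k i)
    (hE : secondFormQuad lam h + -(1 / ((n : ℝ) + 1)) * ∑ k, secondFormTrace lam h k ^ 2 ≤ 0) :
    ∀ a i k, h a i k = 0 := by
  refine eq_zero_of_antisymm_of_symm hs ?_
  have hn : (0 : ℝ) < (n : ℝ) + 1 := by positivity
  -- Cauchy–Schwarz costs a factor `n`, and `n/(n+1) ≤ 1`, so the trace is absorbed by the `a = i`
  -- terms of the indefinite part. The denominator `n + 1` keeps the coefficient nonzero for `n =
  -- 0`.
  have h1 : 1 / ((n : ℝ) + 1) * ∑ k, secondFormTrace lam h k ^ 2 ≤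
      ∑ a, ∑ i, ∑ k, if a = i then (lam i * h i i k) ^ 2 else 0 := by
    have h2 : ∀ k, secondFormTrace lam h k ^ 2 ≤ n * ∑ i, (lam i * h i i k) ^ 2 := fun k => by
      simpa [secondFormTrace] using
        sq_sum_le_card_mul_sum_sq (s := Finset.univ) (f := fun i => lam i * h i i k)
    have h3 : ∑ a, ∑ i, ∑ k, (if a = i then (lam i * h i i k) ^ 2 else 0) =
        ∑ k, ∑ i, (lam i * h i i k) ^ 2 := by
      rw [Finset.sum_comm' (t' := Finset.univ) (s' := fun _ => Finset.univ) (by simp)]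
      rw [Finset.sum_comm (f := fun k i => (lam i * h i i k) ^ 2)]
      refine Finset.sum_congr rfl fun i _ => ?_
      rw [Finset.sum_comm]
      simp
    rw [h3, one_div, inv_mul_le_iff₀ hn]
    calc _ ≤ ∑ k, n * ∑ i, (lam i * h i i k) ^ 2 := Finset.sum_le_sum fun k _ => h2 k
      _ = n * ∑ k, ∑ i, (lam i * h i i k) ^ 2 := by rw [Finset.mul_sum]
      _ ≤ _ := by
        have : 0 ≤ ∑ k, ∑ i, (lam i * h i i k) ^ 2 :=
          Finset.sum_nonneg fun k _ => Finset.sum_nonneg fun i _ => sq_nonneg _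
        linarith
  set q : Fin n → Fin n → Fin n → ℝ := fun a i k =>
    h a i k ^ 2 + lam a * lam i * (h a i k * h i a k) -
      if a = i then (lam i * h i i k) ^ 2 else 0 with hq
  have h4 : ∑ a, ∑ i, ∑ k, q a i k ≤ 0 := by
    simp only [hq, Finset.sum_sub_distrib]
    simp only [secondFormQuad] at hE
    linarith
  have h5 : ∀ a i k, (h a i k + h i a k) ^ 2 ≤ 2 * (q a i k + q i a k) := by
    intro a i k
    by_cases hai : a = i
    · subst hai
      simp only [hq, if_true]
      nlinarith
    · simp only [hq, hai, Ne.symm hai, if_false]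
      have hs0 := mul_nonneg (hlam a) (hlam i)
      have hs1 := hle a i hai
      -- With `s = λ_a λ_i ∈ [0,1]`, `2(X² + Y² + 2sXY) - (X+Y)² = (1-s)(X-Y)² + s(X+Y)²`.
      nlinarith [mul_nonneg hs0 (sq_nonneg (h a i k + h i a k)),
        mul_nonneg (sub_nonneg.2 hs1) (sq_nonneg (h a i k - h i a k))]
  have h6 : ∑ a, ∑ i, ∑ k, (h a i k + h i a k) ^ 2 ≤ 0 := by
    calc _ ≤ ∑ a, ∑ i, ∑ k, 2 * (q a i k + q i a k) :=
          Finset.sum_le_sum fun a _ => Finset.sum_le_sum fun i _ => Finset.sum_le_sum fun k _ =>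
            h5 a i k
      _ = 2 * (∑ a, ∑ i, ∑ k, q a i k + ∑ a, ∑ i, ∑ k, q i a k) := by
          simp only [← Finset.mul_sum, Finset.sum_add_distrib]
      _ ≤ 0 := by
          rw [Finset.sum_comm (f := fun a i => ∑ k, q i a k)]
          linarith
  intro a i k
  have h7 : ∑ p : Fin n × Fin n × Fin n, (h p.1 p.2.1 p.2.2 + h p.2.1 p.1 p.2.2) ^ 2 ≤ 0 := by
    simpa only [Fintype.sum_prod_type] using h6
  exact eq_zero_of_sum_sq_nonpos h7 (a, i, k) (Finset.mem_univ _)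

/-! ### Definiteness of the quadratic form when `∏ (1 + λ_i²) < 9`. -/

/-- The ternary form that governs the components of the second fundamental form with three
distinct indices. -/
theorem ternary_form_definite_aux {a b c x y z : ℝ} (ha : 2 ≤ a ^ 2)
    (habc : (1 + a ^ 2) * (1 + b ^ 2) * (1 + c ^ 2) < 9)
    (h : x ^ 2 + y ^ 2 + z ^ 2 + a * b * (x * y) + b * c * (y * z) + c * a * (z * x) ≤ 0) :
    x = 0 ∧ y = 0 ∧ z = 0 := by
  set q := b ^ 2 + c ^ 2 + b ^ 2 * c ^ 2 with hq
  have hq0 : 0 ≤ q := by positivity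
  have h1 : (1 + a ^ 2) * (1 + q) < 9 := by
    rw [hq]
    linarith
  have hq2 : q < 2 := by nlinarith
  -- Here `1 + q = (1+b²)(1+c²)`. By AM–GM `(1 + √(a²q))² ≤ (1+a²)(1+q) < 9`, so `a²q < 4`: this is
  -- what makes the discriminant in `x` negative.
  have haq : a ^ 2 * q < 4 := by nlinarith
  set t := b * y + c * z with ht
  have h2 : t ^ 2 ≤ q * (y ^ 2 + z ^ 2 + b * c * (y * z)) := by
    have e : 0 ≤ (c ^ 2 + b ^ 2 * c ^ 2) * y ^ 2 + (b ^ 2 + b ^ 2 * c ^ 2) * z ^ 2 +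
        b * c * (q - 2) * (y * z) := by
      nlinarith [sq_nonneg (c * y - b * z), sq_nonneg (c * y + b * z),
        mul_nonneg hq0 (sq_nonneg (c * y + b * z)), mul_nonneg hq0 (sq_nonneg (c * y - b * z)),
        mul_nonneg (sub_nonneg.2 hq2.le) (sq_nonneg (c * y - b * z)),
        mul_nonneg (sub_nonneg.2 hq2.le) (sq_nonneg (c * y + b * z)),
        sq_nonneg (b * c * y), sq_nonneg (b * c * z)]
    rw [ht]
    nlinarith
  set w := y ^ 2 + z ^ 2 + b * c * (y * z) with hw
  have h3 : x ^ 2 + a * x * t + w ≤ 0 := by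
    rw [hw, ht]
    linarith
  have hbc : (b * c) ^ 2 < 2 := by nlinarith [sq_nonneg b, sq_nonneg c]
  have hw0 : y ^ 2 + z ^ 2 ≤ 4 * w := by
    have e1 : b * c ≤ 3 / 2 := by nlinarith
    have e2 : -(3 / 2) ≤ b * c := by nlinarith
    rw [hw]
    nlinarith [mul_nonneg (sub_nonneg.2 e1) (sq_nonneg (y - z)),
      mul_nonneg (sub_nonneg.2 e2) (sq_nonneg (y + z))]
  have hwn : 0 ≤ w := by
    have := sq_nonneg y
    have := sq_nonneg z
    linarith
  have h4 : a ^ 2 * t ^ 2 ≤ a ^ 2 * q * w := by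
    have := mul_le_mul_of_nonneg_left h2 (sq_nonneg a)
    linarith
  have h5 : (4 - a ^ 2 * q) * w ≤ 0 := by
    nlinarith [sq_nonneg (2 * x + a * t)]
  have hw1 : w = 0 := by
    apply le_antisymm _ hwn
    by_contra hcon
    push Not at hcon
    have := mul_pos (sub_pos.2 haq) hcon
    linarith
  rw [hw1] at hw0 h2 h3
  have hy : y = 0 := by
    have : y ^ 2 = 0 := by
      apply le_antisymm _ (sq_nonneg y)
      linarith [sq_nonneg z]
    simpa using this
  have hz : z = 0 := by
    have : z ^ 2 = 0 := by
      apply le_antisymm _ (sq_nonneg z)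
      linarith [sq_nonneg y]
    simpa using this
  refine ⟨?_, hy, hz⟩
  rw [ht, hy, hz] at h3
  have : x ^ 2 = 0 := by
    apply le_antisymm _ (sq_nonneg x)
    linarith
  simpa using this

/-- If all three squares are below 2, twice the form is `(ax+by+cz)² + (2-a²)x² + (2-b²)y² +
(2-c²)z²`. Otherwise cyclic symmetry puts the large coefficient first. -/
theorem ternary_form_definite {a b c x y z : ℝ}
    (habc : (1 + a ^ 2) * (1 + b ^ 2) * (1 + c ^ 2) < 9)
    (h : x ^ 2 + y ^ 2 + z ^ 2 + a * b * (x * y) + b * c * (y * z) + c * a * (z * x) ≤ 0) :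
    x = 0 ∧ y = 0 ∧ z = 0 := by
  by_cases ha : 2 ≤ a ^ 2
  · exact ternary_form_definite_aux ha habc h
  by_cases hb : 2 ≤ b ^ 2
  · obtain ⟨hy, hz, hx⟩ := ternary_form_definite_aux (a := b) (b := c) (c := a) (x := y) (y := z)
      (z := x) hb (by linarith) (by linarith)
    exact ⟨hx, hy, hz⟩
  by_cases hc : 2 ≤ c ^ 2
  · obtain ⟨hz, hx, hy⟩ := ternary_form_definite_aux (a := c) (b := a) (c := b) (x := z) (y := x)
      (z := y) hc (by linarith) (by linarith)
    exact ⟨hx, hy, hz⟩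
  push Not at ha hb hc
  have h1 : (a * x + b * y + c * z) ^ 2 + ((2 - a ^ 2) * x ^ 2 + (2 - b ^ 2) * y ^ 2 +
      (2 - c ^ 2) * z ^ 2) ≤ 0 := by linarith
  have hx := mul_nonneg (sub_pos.2 ha).le (sq_nonneg x)
  have hy := mul_nonneg (sub_pos.2 hb).le (sq_nonneg y)
  have hz := mul_nonneg (sub_pos.2 hc).le (sq_nonneg z)
  have h0 := sq_nonneg (a * x + b * y + c * z)
  have zero : ∀ {s r : ℝ}, 0 < s → s * r ^ 2 ≤ 0 → r = 0 := fun {s r} hs hr => by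
    have := nonpos_of_mul_nonpos_right hr hs
    exact pow_eq_zero_iff (two_ne_zero) |>.1 (le_antisymm this (sq_nonneg r))
  exact ⟨zero (sub_pos.2 ha) (by linarith), zero (sub_pos.2 hb) (by linarith),
    zero (sub_pos.2 hc) (by linarith)⟩

theorem one_add_sum_le_prod_one_add {ι : Type*} (s : Finset ι) {f : ι → ℝ}
    (hf : ∀ i, 0 ≤ f i) : 1 + ∑ i ∈ s, f i ≤ ∏ i ∈ s, (1 + f i) := by
  classical
  induction s using Finset.induction_on with
  | empty => simp
  | insert i s hi ih =>
    rw [Finset.sum_insert hi, Finset.prod_insert hi]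
    have h1 : 0 ≤ ∑ i ∈ s, f i := Finset.sum_nonneg fun i _ => hf i
    nlinarith [hf i, mul_nonneg (hf i) h1]

/-- Numerical control when one index has a nonpositive coefficient. AM–GM gives `p + 2B ≥ 4`, so
`(2+p)(1+B) ≥ 8`, and the factor left for the other indices is below `9/8`. -/
theorem large_index_bounds {p B σ : ℝ} (hB : 0 ≤ B) (hp : 2 ≤ p * B) (hσ : 0 ≤ σ)
    (hprod : (2 + p) * (1 + B) * (1 + σ) < 9) :
    0 < p ∧ p < 4 ∧ σ < 1 / 8 ∧ p * B - 2 ≤ 3 / 5 * B := by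
  have hB0 : 0 < B := by
    rcases hB.eq_or_lt with h | h
    · rw [← h] at hp
      linarith
    · exact h
  have hp0 : 0 < p := by
    by_contra hcon
    push Not at hcon
    nlinarith
  have h4 : 4 ≤ p + 2 * B := by
    nlinarith [sq_nonneg (p - 2 * B)]
  have h8 : 8 ≤ (2 + p) * (1 + B) := by linarith
  have h9 : (2 + p) * (1 + B) < 9 := by
    have := mul_nonneg (by linarith : (0 : ℝ) ≤ (2 + p) * (1 + B)) hσ
    linarith
  refine ⟨hp0, ?_, ?_, ?_⟩
  · by_contra hcon
    push Not at hcon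
    nlinarith
  · by_contra hcon
    push Not at hcon
    nlinarith
  · by_contra hcon
    push Not at hcon
    -- With `p' = p - 3/5` and `p'B > 2`, AM–GM on `p'` and `13/5 B` pushes `(13/5 + p')(1+B) =
    -- (2+p)(1+B)` above 9.
    nlinarith [sq_nonneg (p - 3 / 5 - 13 / 5 * B)]

/-- If some coefficient is nonpositive, at an index `i₀`, all others are at least `3/2`. The
negative term is compensated by the squared trace, since `l i₀ * x i₀` is the trace minus the
remaining contributions. -/
theorem trace_form_definite_reduced {ι : Type*} [DecidableEq ι] {s : Finset ι} {a X : ℝ}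
    {l x : ι → ℝ} (hprod : (1 + a ^ 2) * ∏ i ∈ s, (1 + l i ^ 2) < 9)
    (h : (1 + a ^ 2) * X ^ 2 + ∑ i ∈ s, (2 + l i ^ 2 - a ^ 2 * l i ^ 2) * x i ^ 2 +
      2 * (a * X + ∑ i ∈ s, l i * x i) ^ 2 ≤ 0) : X = 0 ∧ ∀ i ∈ s, x i = 0 := by
  by_cases hall : ∀ i ∈ s, 0 < 2 + l i ^ 2 - a ^ 2 * l i ^ 2
  · have h1 : ∀ i ∈ s, 0 ≤ (2 + l i ^ 2 - a ^ 2 * l i ^ 2) * x i ^ 2 := fun i hi =>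
      mul_nonneg (hall i hi).le (sq_nonneg _)
    have h2 := Finset.sum_nonneg h1
    have h3 := sq_nonneg (a * X + ∑ i ∈ s, l i * x i)
    have h4 : 0 ≤ a ^ 2 * X ^ 2 := by positivity
    have h5 := sq_nonneg X
    refine ⟨by simpa using (le_antisymm (by linarith) h5 : X ^ 2 = 0), fun i hi => ?_⟩
    have h6 := (Finset.sum_eq_zero_iff_of_nonneg h1).1 (le_antisymm (by linarith) h2) i hi
    simpa [(hall i hi).ne'] using h6
  · push Not at hall
    obtain ⟨i₀, hi₀, hle⟩ := hall
    rw [← Finset.mul_prod_erase _ _ hi₀] at hprod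
    rw [← Finset.add_sum_erase _ _ hi₀, ← Finset.add_sum_erase _ _ hi₀] at h
    set r := s.erase i₀ with hr
    set B := l i₀ ^ 2 with hB
    set σ := ∑ i ∈ r, l i ^ 2 with hσ
    set W := ∑ i ∈ r, x i ^ 2 with hW
    set τ := ∑ i ∈ r, l i * x i with hτ
    set p := a ^ 2 - 1 with hp
    have hB0 : 0 ≤ B := sq_nonneg _
    have hσ0 : 0 ≤ σ := Finset.sum_nonneg fun i _ => sq_nonneg _
    have hW0 : 0 ≤ W := Finset.sum_nonneg fun i _ => sq_nonneg _
    have hpB : 2 ≤ p * B := by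
      rw [hp]
      linarith
    have hσr : 1 + σ ≤ ∏ i ∈ r, (1 + l i ^ 2) :=
      one_add_sum_le_prod_one_add r fun i => sq_nonneg (l i)
    obtain ⟨hp0, hp4, hσ8, hpB5⟩ := large_index_bounds hB0 hpB hσ0 (by
      refine lt_of_le_of_lt ?_ hprod
      rw [mul_assoc, hp]
      have h1 : (2 + (a ^ 2 - 1)) = 1 + a ^ 2 := by ring
      rw [h1]
      gcongr)
    have hτW : 8 * τ ^ 2 ≤ W := by
      have h1 : τ ^ 2 ≤ σ * W := Finset.sum_mul_sq_le_sq_mul_sq r l x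
      nlinarith
    have hsum : 3 / 2 * W ≤ ∑ i ∈ r, (2 + l i ^ 2 - a ^ 2 * l i ^ 2) * x i ^ 2 := by
      rw [hW, Finset.mul_sum]
      refine Finset.sum_le_sum fun i hi => ?_
      have h1 : l i ^ 2 ≤ σ := Finset.single_le_sum (f := fun i => l i ^ 2)
        (fun i _ => sq_nonneg _) hi
      have h2 : p * l i ^ 2 ≤ 1 / 2 := by
        have := sq_nonneg (l i)
        nlinarith
      have h3 : 3 / 2 ≤ 2 + l i ^ 2 - a ^ 2 * l i ^ 2 := by
        rw [hp] at h2
        linarith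
      exact mul_le_mul_of_nonneg_right h3 (sq_nonneg _)
    set θ := a * X + (l i₀ * x i₀ + τ) with hθ
    have h1 : (2 + B - a ^ 2 * B) * x i₀ ^ 2 ≥ -(3 / 5) * (θ - a * X - τ) ^ 2 := by
      have e : θ - a * X - τ = l i₀ * x i₀ := by
        rw [hθ]
        ring
      rw [e, mul_pow, ← hB]
      have e2 : (p * B - 2) * x i₀ ^ 2 ≤ 3 / 5 * B * x i₀ ^ 2 :=
        mul_le_mul_of_nonneg_right hpB5 (sq_nonneg _)
      rw [hp] at e2
      linarith
    -- Weighted Cauchy–Schwarz with `1/2 + 1 + 1/12 = 19/12`. After the factor `3/5` the coefficient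
    -- is `19/20`, which leaves every term of `h3` a positive remainder.
    have h2 : (θ - a * X - τ) ^ 2 ≤ 19 / 12 * (2 * θ ^ 2 + a ^ 2 * X ^ 2 + 12 * τ ^ 2) := by
      nlinarith [sq_nonneg (2 * θ + a * X), sq_nonneg (a * X - 12 * τ), sq_nonneg (θ + 6 * τ)]
    have h3 : X ^ 2 + 1 / 20 * (a ^ 2 * X ^ 2) + 3 / 40 * W + 1 / 10 * θ ^ 2 ≤ 0 := by
      linarith
    have e0 : 0 ≤ a ^ 2 * X ^ 2 := by positivity
    have e1 := sq_nonneg X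
    have e2 := sq_nonneg θ
    have hX : X = 0 := by simpa using (le_antisymm (by linarith) e1 : X ^ 2 = 0)
    have hθ0 : θ = 0 := by simpa using (le_antisymm (by linarith) e2 : θ ^ 2 = 0)
    have hWz : W = 0 := le_antisymm (by linarith) hW0
    have hx := eq_zero_of_sum_sq_nonpos hWz.le
    have hτ0 : τ = 0 := Finset.sum_eq_zero fun i hi => by rw [hx i hi, mul_zero]
    refine ⟨hX, fun i hi => ?_⟩
    by_cases hi0 : i = i₀
    · subst hi0
      rw [hθ, hX, hτ0] at hθ0
      have hl : l i ≠ 0 := by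
        intro h0
        rw [hB, h0] at hpB
        norm_num at hpB
      simpa [hl] using hθ0
    · exact hx i (Finset.mem_erase.2 ⟨hi0, hi⟩)

/-- The form that governs the components of the second fundamental form with a repeated index. -/
theorem trace_form_definite {ι : Type*} [DecidableEq ι] {s : Finset ι} {a X : ℝ}
    {l x y : ι → ℝ} (hprod : (1 + a ^ 2) * ∏ i ∈ s, (1 + l i ^ 2) < 9)
    (h : (1 + a ^ 2) * X ^ 2 +
      ∑ i ∈ s, ((2 + l i ^ 2) * x i ^ 2 + y i ^ 2 + 2 * (a * l i * (x i * y i))) +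
      2 * (a * X + ∑ i ∈ s, l i * x i) ^ 2 ≤ 0) :
    X = 0 ∧ (∀ i ∈ s, x i = 0) ∧ ∀ i ∈ s, y i = 0 := by
  -- Completing the square in `y i` reduces to a form in `X` and `x` alone.
  have h1 : ∑ i ∈ s, ((2 + l i ^ 2) * x i ^ 2 + y i ^ 2 + 2 * (a * l i * (x i * y i))) =
      ∑ i ∈ s, (2 + l i ^ 2 - a ^ 2 * l i ^ 2) * x i ^ 2 +
        ∑ i ∈ s, (y i + a * l i * x i) ^ 2 := by
    rw [← Finset.sum_add_distrib]
    exact Finset.sum_congr rfl fun i _ => by ring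
  have h2 : 0 ≤ ∑ i ∈ s, (y i + a * l i * x i) ^ 2 := Finset.sum_nonneg fun i _ => sq_nonneg _
  obtain ⟨hX, hx⟩ := trace_form_definite_reduced (X := X) (x := x) hprod (by linarith)
  refine ⟨hX, hx, ?_⟩
  have e1 : ∑ i ∈ s, (2 + l i ^ 2 - a ^ 2 * l i ^ 2) * x i ^ 2 = 0 :=
    Finset.sum_eq_zero fun i hi => by rw [hx i hi]; ring
  have e2 : ∑ i ∈ s, (y i + a * l i * x i) ^ 2 ≤ 0 := by
    rw [h1, e1, hX] at h
    have := sq_nonneg (a * 0 + ∑ i ∈ s, l i * x i)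
    linarith
  intro i hi
  have e3 := eq_zero_of_sum_sq_nonpos e2 i hi
  rw [hx i hi] at e3
  linarith

theorem sum_rotate (f : Fin n → Fin n → Fin n → ℝ) :
    ∑ a, ∑ i, ∑ k, f i k a = ∑ a, ∑ i, ∑ k, f a i k := by
  rw [Finset.sum_comm]
  exact Finset.sum_congr rfl fun i _ => Finset.sum_comm

/-- A triple that is not pairwise distinct belongs to exactly one block: that of its unrepeated
index `k`, or of `k` itself for `(k,k,k)`. -/
theorem sum_split_distinct (f : Fin n → Fin n → Fin n → ℝ) :
    ∑ a, ∑ i, ∑ k, f a i k =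
      ∑ a, ∑ i, ∑ k, (if a ≠ i ∧ i ≠ k ∧ k ≠ a then f a i k else 0) +
      ∑ k, (f k k k + ∑ i ∈ Finset.univ.erase k, (f i i k + f i k i + f k i i)) := by
  have h1 : ∀ a i k, f a i k = (if a ≠ i ∧ i ≠ k ∧ k ≠ a then f a i k else 0) +
      ((if a = i then f i i k else 0) + (if k = a then (if i ≠ a then f a i a else 0) else 0) +
        (if k = i then (if i ≠ a then f a i i else 0) else 0)) := by
    intro a i k
    by_cases h1 : a = i <;> by_cases h2 : i = k <;> by_cases h3 : k = a <;> grind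
  have h2 : ∀ k (g : Fin n → ℝ), ∑ i ∈ Finset.univ.erase k, g i = ∑ i, if i ≠ k then g i else 0 :=
    fun k g => by
      rw [← Finset.sum_filter]
      congr 1
      ext
      simp
  have h3 : ∑ a, ∑ i, ∑ k, (if a = i then f i i k else 0) =
      ∑ k, (f k k k + ∑ i ∈ Finset.univ.erase k, f i i k) := by
    rw [← sum_rotate]
    refine Finset.sum_congr rfl fun k _ => ?_
    rw [Finset.add_sum_erase _ (fun i => f i i k) (Finset.mem_univ k)]
    exact Finset.sum_congr rfl fun i _ => by simp
  have h4 : ∑ a, ∑ i, ∑ k, f a i k = ∑ a, ∑ i, ∑ k,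
      ((if a ≠ i ∧ i ≠ k ∧ k ≠ a then f a i k else 0) +
      ((if a = i then f i i k else 0) + (if k = a then (if i ≠ a then f a i a else 0) else 0) +
        (if k = i then (if i ≠ a then f a i i else 0) else 0))) :=
    Finset.sum_congr rfl fun a _ => Finset.sum_congr rfl fun i _ => Finset.sum_congr rfl
      fun k _ => h1 a i k
  rw [h4]
  simp only [Finset.sum_add_distrib, h3]
  simp only [Finset.sum_ite_eq', Finset.mem_univ, if_true, h2]
  rw [Finset.sum_comm (f := fun a i => if i ≠ a then f a i a else 0)]
  simp only [ne_comm, add_assoc]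

/-- The form decouples. Cyclic orbits of distinct indices give ternary forms, and for each `k` the
entries `h_{kkk}`, `h_{iik}`, `h_{kii}` together with `S_k` give one trace form. Each block involves
only factors of the product, so each is definite. -/
theorem eq_zero_of_prod_lt_nine {lam : Fin n → ℝ} {h : Fin n → Fin n → Fin n → ℝ}
    (hprod : ∏ i, (1 + lam i ^ 2) < 9)
    (hs : ∀ a i k, h a i k = h a k i)
    (hE : secondFormQuad lam h + 2 * ∑ k, secondFormTrace lam h k ^ 2 ≤ 0) :
    ∀ a i k, h a i k = 0 := by
  set f : Fin n → Fin n → Fin n → ℝ := fun a i k =>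
    h a i k ^ 2 + lam a * lam i * (h a i k * h i a k) with hf
  set D : Fin n → Fin n → Fin n → ℝ := fun a i k =>
    if a ≠ i ∧ i ≠ k ∧ k ≠ a then f a i k + f i k a + f k a i else 0 with hD
  set Q : Fin n → ℝ := fun k =>
    (f k k k + ∑ i ∈ Finset.univ.erase k, (f i i k + f i k i + f k i i)) +
      2 * secondFormTrace lam h k ^ 2 with hQ
  have hone : ∀ s : Finset (Fin n), 1 ≤ ∏ i ∈ s, (1 + lam i ^ 2) := fun s =>
    (le_add_of_nonneg_right (Finset.sum_nonneg fun i _ => sq_nonneg (lam i))).trans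
      (one_add_sum_le_prod_one_add s fun i => sq_nonneg (lam i))
  have hD0 : ∀ a i k, a ≠ i → i ≠ k → k ≠ a → D a i k ≤ 0 → h a i k = 0 := by
    intro a i k h1 h2 h3 h4
    have hp : (1 + lam a ^ 2) * (1 + lam i ^ 2) * (1 + lam k ^ 2) < 9 := by
      refine lt_of_le_of_lt ?_ hprod
      have e : ∏ j ∈ ({a, i, k} : Finset (Fin n)), (1 + lam j ^ 2) =
          (1 + lam a ^ 2) * (1 + lam i ^ 2) * (1 + lam k ^ 2) := by
        rw [Finset.prod_insert (by simp [h1, h3.symm]), Finset.prod_insert (by simp [h2]),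
          Finset.prod_singleton, mul_assoc]
      rw [← e, ← Finset.prod_mul_prod_compl {a, i, k}]
      exact le_mul_of_one_le_right (by linarith [hone {a, i, k}]) (hone _)
    refine (ternary_form_definite (x := h a i k) (y := h i k a) (z := h k a i) hp ?_).1
    simp only [hD, h1, h2, h3, ne_eq, not_false_eq_true, and_self, if_true, hf] at h4
    rw [hs i a k, hs k i a, hs a k i] at h4
    linarith
  -- Definiteness in the form "nonpositive implies zero entries" yields nonnegativity: a negative
  -- value would force zero entries, hence the value 0. The same argument gives `hQn`.
  have hDn : ∀ a i k, 0 ≤ D a i k := by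
    intro a i k
    by_contra hcon
    push Not at hcon
    have hdist : a ≠ i ∧ i ≠ k ∧ k ≠ a := by
      by_contra h1
      simp [hD, h1] at hcon
    obtain ⟨h1, h2, h3⟩ := hdist
    have e1 := hD0 a i k h1 h2 h3 hcon.le
    have e2 := hD0 i k a h2 h3 h1 (by
      refine le_trans (le_of_eq ?_) hcon.le
      simp only [hD, h1, h2, h3, ne_eq, not_false_eq_true, and_self, if_true]
      ring)
    have e3 := hD0 k a i h3 h1 h2 (by
      refine le_trans (le_of_eq ?_) hcon.le
      simp only [hD, h1, h2, h3, ne_eq, not_false_eq_true, and_self, if_true]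
      ring)
    simp [hD, hf, e1, e2, e3] at hcon
  have hQ0 : ∀ k, Q k ≤ 0 → h k k k = 0 ∧ (∀ i ∈ Finset.univ.erase k, h i i k = 0) ∧
      ∀ i ∈ Finset.univ.erase k, h k i i = 0 := by
    intro k hk
    refine trace_form_definite (a := lam k) (l := lam) (s := Finset.univ.erase k) ?_ ?_
    · rw [Finset.mul_prod_erase _ (fun i => 1 + lam i ^ 2) (Finset.mem_univ k)]
      exact hprod
    · refine le_trans (le_of_eq ?_) hk
      have e1 : secondFormTrace lam h k =
          lam k * h k k k + ∑ i ∈ Finset.univ.erase k, lam i * h i i k :=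
        (Finset.add_sum_erase _ (fun i => lam i * h i i k) (Finset.mem_univ k)).symm
      simp only [hQ, e1]
      congr 1
      congr 1
      · simp only [hf]
        ring
      · refine Finset.sum_congr rfl fun i _ => ?_
        simp only [hf]
        rw [hs i k i]
        ring
  have hQn : ∀ k, 0 ≤ Q k := by
    intro k
    by_contra hcon
    push Not at hcon
    obtain ⟨e1, e2, e3⟩ := hQ0 k hcon.le
    have e4 : ∑ i ∈ Finset.univ.erase k, (f i i k + f i k i + f k i i) = 0 :=
      Finset.sum_eq_zero fun i hi => by
        simp only [hf]
        rw [hs i k i, e2 i hi, e3 i hi]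
        ring
    have e5 : f k k k = 0 := by simp [hf, e1]
    simp only [hQ, e4, e5] at hcon
    linarith [sq_nonneg (secondFormTrace lam h k)]
  set T := ∑ a, ∑ i, ∑ k, (if a ≠ i ∧ i ≠ k ∧ k ≠ a then f a i k else 0) with hT
  have hT3 : 3 * T = ∑ a, ∑ i, ∑ k, D a i k := by
    set g : Fin n → Fin n → Fin n → ℝ := fun a i k =>
      if a ≠ i ∧ i ≠ k ∧ k ≠ a then f a i k else 0 with hg
    have e : ∀ a i k, D a i k = g a i k + g i k a + g k a i := by
      intro a i k
      by_cases h1 : a ≠ i ∧ i ≠ k ∧ k ≠ a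
      · have h2 : i ≠ k ∧ k ≠ a ∧ a ≠ i := by tauto
        have h3 : k ≠ a ∧ a ≠ i ∧ i ≠ k := by tauto
        simp only [hD, hg, if_pos h1, if_pos h2, if_pos h3]
      · have h2 : ¬(i ≠ k ∧ k ≠ a ∧ a ≠ i) := by tauto
        have h3 : ¬(k ≠ a ∧ a ≠ i ∧ i ≠ k) := by tauto
        simp only [hD, hg, if_neg h1, if_neg h2, if_neg h3, add_zero]
    simp only [e, Finset.sum_add_distrib]
    rw [sum_rotate g, sum_rotate (fun a i k => g i k a), sum_rotate g]
    ring
  have hTn : 0 ≤ ∑ a, ∑ i, ∑ k, D a i k := Finset.sum_nonneg fun a _ =>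
    Finset.sum_nonneg fun i _ => Finset.sum_nonneg fun k _ => hDn a i k
  have htot : T + ∑ k, Q k ≤ 0 := by
    refine le_trans (le_of_eq ?_) hE
    rw [secondFormQuad, sum_split_distinct f]
    simp only [hQ, Finset.sum_add_distrib, Finset.mul_sum, hT]
    ring
  have hQs : 0 ≤ ∑ k, Q k := Finset.sum_nonneg fun k _ => hQn k
  have hQz : ∀ k, Q k = 0 := fun k =>
    (Finset.sum_eq_zero_iff_of_nonneg fun k _ => hQn k).1 (le_antisymm (by linarith) hQs) k
      (Finset.mem_univ k)
  have hDz : ∀ a i k, D a i k ≤ 0 := by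
    have e : ∑ a, ∑ i, ∑ k, D a i k ≤ 0 := by linarith
    intro a i k
    refine le_trans ?_ e
    refine (Finset.single_le_sum (f := fun k => D a i k) (fun k _ => hDn a i k)
      (Finset.mem_univ k)).trans ?_
    refine (Finset.single_le_sum (f := fun i => ∑ k, D a i k)
      (fun i _ => Finset.sum_nonneg fun k _ => hDn a i k) (Finset.mem_univ i)).trans ?_
    exact Finset.single_le_sum (f := fun a => ∑ i, ∑ k, D a i k)
      (fun a _ => Finset.sum_nonneg fun i _ => Finset.sum_nonneg fun k _ => hDn a i k)
      (Finset.mem_univ a)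
  intro a i k
  by_cases h1 : a = i
  · subst h1
    by_cases h2 : a = k
    · subst h2
      exact (hQ0 a (hQz a).le).1
    · exact (hQ0 k (hQz k).le).2.1 a (Finset.mem_erase.2 ⟨h2, Finset.mem_univ _⟩)
  · by_cases h2 : i = k
    · subst h2
      exact (hQ0 a (hQz a).le).2.2 i (Finset.mem_erase.2 ⟨Ne.symm h1, Finset.mem_univ _⟩)
    · by_cases h3 : k = a
      · subst h3
        rw [hs]
        exact (hQ0 i (hQz i).le).2.1 k (Finset.mem_erase.2 ⟨h1, Finset.mem_univ _⟩)
      · exact hD0 a i k h1 h2 h3 (hDz a i k)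

/-! ### Tensor contractions in a frame, and the singular value frame of `du`. -/

theorem contract_eq_sum {G : Matrix (Fin n) (Fin n) ℝ} {γ : Fin n → ℝ} {e : Fin n → Fin n → ℝ}
    (hG : ∀ i j, G i j = ∑ s, γ s * (e s i * e s j)) (Z : Fin n → Fin n → ℝ) :
    ∑ i, ∑ j, G i j * Z i j = ∑ s, γ s * ∑ i, ∑ j, e s i * e s j * Z i j := by
  simp only [hG, Finset.sum_mul, Finset.mul_sum]
  calc _ = ∑ i, ∑ s, ∑ j, γ s * (e s i * e s j) * Z i j :=
        Finset.sum_congr rfl fun i _ => Finset.sum_comm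
    _ = _ := by
        rw [Finset.sum_comm]
        exact Finset.sum_congr rfl fun s _ => Finset.sum_congr rfl fun i _ =>
          Finset.sum_congr rfl fun j _ => by ring

theorem contract_mul_eq_sum {G : Matrix (Fin n) (Fin n) ℝ} {γ : Fin n → ℝ}
    {e : Fin n → Fin n → ℝ} (hG : ∀ i j, G i j = ∑ s, γ s * (e s i * e s j))
    (X Y : Fin n → ℝ) :
    ∑ i, ∑ j, G i j * (X i * Y j) =
      ∑ s, γ s * ((∑ i, e s i * X i) * ∑ j, e s j * Y j) := by
  rw [contract_eq_sum hG]
  refine Finset.sum_congr rfl fun s _ => ?_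
  rw [Finset.sum_mul_sum]
  congr 1
  exact Finset.sum_congr rfl fun i _ => Finset.sum_congr rfl fun j _ => by ring

theorem contract_sum_comm (G : Matrix (Fin n) (Fin n) ℝ) (w : Fin n → ℝ)
    (F : Fin n → Fin n → Fin n → ℝ) :
    ∑ i, ∑ j, G i j * ∑ t, w t * F t i j = ∑ t, w t * ∑ i, ∑ j, G i j * F t i j := by
  simp only [Finset.mul_sum]
  calc _ = ∑ i, ∑ t, ∑ j, G i j * (w t * F t i j) :=
        Finset.sum_congr rfl fun i _ => Finset.sum_comm
    _ = _ := by
        rw [Finset.sum_comm]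
        exact Finset.sum_congr rfl fun s _ => Finset.sum_congr rfl fun i _ =>
          Finset.sum_congr rfl fun j _ => by ring

/-- The components of a `2`-tensor in the frame `e`. -/
def rotate₂ (e : Fin n → Fin n → ℝ) (X : Fin n → Fin n → ℝ) (s t : Fin n) : ℝ :=
  ∑ k, e t k * ∑ i, e s i * X i k

/-- The components of a `3`-tensor in the frame `e`. -/
def rotate₃ (e : Fin n → Fin n → ℝ) (X : Fin n → Fin n → Fin n → ℝ) (s t r : Fin n) : ℝ :=
  ∑ k, e r k * ∑ i, e s i * ∑ j, e t j * X i j k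

theorem contract₂_eq_sum {G : Matrix (Fin n) (Fin n) ℝ} {γ : Fin n → ℝ}
    {e : Fin n → Fin n → ℝ} (hG : ∀ i j, G i j = ∑ s, γ s * (e s i * e s j))
    (X : Fin n → Fin n → ℝ) :
    contract₂ G X X = ∑ s, γ s * ∑ t, γ t * rotate₂ e X s t ^ 2 := by
  unfold contract₂
  simp only [contract_mul_eq_sum hG, contract_sum_comm]
  refine Finset.sum_congr rfl fun s _ => ?_
  congr 1
  have h : ∀ k l, (∑ i, e s i * X i l) * ∑ j, e s j * X j k =
      (∑ i, e s i * X i k) * ∑ j, e s j * X j l := fun k l => mul_comm _ _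
  simp only [h, contract_mul_eq_sum hG, rotate₂, sq]

theorem contract₃_eq_sum {G : Matrix (Fin n) (Fin n) ℝ} {γ : Fin n → ℝ}
    {e : Fin n → Fin n → ℝ} (hG : ∀ i j, G i j = ∑ s, γ s * (e s i * e s j))
    (X Y : Fin n → Fin n → Fin n → ℝ) :
    contract₃ G X Y =
      ∑ s, ∑ t, ∑ r, γ s * γ t * γ r * (rotate₃ e X s t r * rotate₃ e Y s t r) := by
  unfold contract₃
  simp only [contract_mul_eq_sum hG, contract_sum_comm]
  symm
  rw [Finset.sum_comm]
  refine Finset.sum_congr rfl fun t _ => ?_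
  rw [Finset.mul_sum]
  refine Finset.sum_congr rfl fun s _ => ?_
  rw [Finset.mul_sum, Finset.mul_sum]
  refine Finset.sum_congr rfl fun r _ => ?_
  simp only [rotate₃]
  ring

theorem rotate₃_eq (e : Fin n → Fin n → ℝ) (X : Fin n → Fin n → Fin n → ℝ) (s t r : Fin n) :
    rotate₃ e X s t r = ∑ i, ∑ j, ∑ k, e s i * e t j * e r k * X i j k := by
  simp only [rotate₃, Finset.mul_sum]
  rw [Finset.sum_comm]
  refine Finset.sum_congr rfl fun i _ => ?_
  rw [Finset.sum_comm]
  exact Finset.sum_congr rfl fun j _ => Finset.sum_congr rfl fun k _ => by ring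

theorem rotate₃_add (e : Fin n → Fin n → ℝ) (X Y : Fin n → Fin n → Fin n → ℝ) (s t r : Fin n) :
    rotate₃ e (fun i j k => X i j k + Y i j k) s t r = rotate₃ e X s t r + rotate₃ e Y s t r := by
  simp only [rotate₃_eq, mul_add, Finset.sum_add_distrib]

theorem rotate₃_swap (e : Fin n → Fin n → ℝ) (X : Fin n → Fin n → Fin n → ℝ) (s t r : Fin n) :
    rotate₃ e (fun i j k => X j i k) s t r = rotate₃ e X t s r := by
  simp only [rotate₃_eq]
  rw [Finset.sum_comm]
  exact Finset.sum_congr rfl fun i _ => Finset.sum_congr rfl fun j _ =>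
    Finset.sum_congr rfl fun k _ => by ring

theorem rotate₃_rotate (e : Fin n → Fin n → ℝ) (X : Fin n → Fin n → Fin n → ℝ) (s t r : Fin n) :
    rotate₃ e (fun i j k => X k i j) s t r = rotate₃ e X r s t := by
  simp only [rotate₃_eq]
  rw [← sum_rotate (fun i j k => e s i * e t j * e r k * X k i j)]
  exact Finset.sum_congr rfl fun i _ => Finset.sum_congr rfl fun j _ =>
    Finset.sum_congr rfl fun k _ => by ring

theorem rotate₂_comm {e : Fin n → Fin n → ℝ} {X : Fin n → Fin n → ℝ}
    (hX : ∀ i j, X i j = X j i) (s t : Fin n) : rotate₂ e X s t = rotate₂ e X t s := by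
  simp only [rotate₂, Finset.mul_sum]
  rw [Finset.sum_comm]
  exact Finset.sum_congr rfl fun i _ => Finset.sum_congr rfl fun k _ => by rw [hX]; ring

theorem eq_zero_of_rotate₂_eq_zero {e : Fin n → Fin n → ℝ}
    (he : ∀ i j, ∑ s, e s i * e s j = if i = j then 1 else 0) {X : Fin n → Fin n → ℝ}
    (h : ∀ s t, rotate₂ e X s t = 0) (i j : Fin n) : X i j = 0 := by
  have inv : ∀ (Y : Fin n → ℝ) (i : Fin n), ∑ s, e s i * ∑ k, e s k * Y k = Y i := by
    intro Y i
    simp only [Finset.mul_sum]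
    rw [Finset.sum_comm]
    have : ∀ k, ∑ s, e s i * (e s k * Y k) = if i = k then Y k else 0 := by
      intro k
      simp only [← mul_assoc, ← Finset.sum_mul, he, ite_mul, one_mul, zero_mul]
    simp [this]
  have h1 : ∀ s k, ∑ i, e s i * X i k = 0 := by
    intro s k
    rw [← inv (fun k => ∑ i, e s i * X i k) k]
    exact Finset.sum_eq_zero fun t _ => by
      have := h s t
      rw [rotate₂] at this
      rw [this, mul_zero]
  rw [← inv (fun i => X i j) i]
  exact Finset.sum_eq_zero fun s _ => by rw [h1, mul_zero]

theorem rotate₃_eq_sum_mul (e : Fin n → Fin n → ℝ) (P : Fin m → Fin n → ℝ)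
    (U : Fin m → Fin n → Fin n → ℝ) (s t r : Fin n) :
    rotate₃ e (fun i j k => ∑ α, P α i * U α j k) s t r =
      ∑ α, (∑ i, e s i * P α i) * rotate₂ e (U α) t r := by
  simp only [rotate₃, rotate₂, Finset.sum_mul, Finset.mul_sum]
  symm
  rw [Finset.sum_comm]
  refine Finset.sum_congr rfl fun k _ => ?_
  rw [Finset.sum_comm]
  symm
  rw [Finset.sum_comm]
  refine Finset.sum_congr rfl fun j _ => ?_
  rw [Finset.sum_comm]
  exact Finset.sum_congr rfl fun α _ => Finset.sum_congr rfl fun i _ => by ring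

/-- A singular value frame of `du` at `x`. -/
theorem exists_singular_frame {u : EuclideanSpace ℝ (Fin n) → EuclideanSpace ℝ (Fin m)}
    (hu : ContDiff ℝ ∞ u) (x : EuclideanSpace ℝ (Fin n)) :
    ∃ e : Fin n → Fin n → ℝ,
      (∀ i j, ∑ s, e s i * e s j = if i = j then 1 else 0) ∧
      (∀ s t, ∑ i, e s i * e t i = if s = t then 1 else 0) ∧
      (∀ s t : Fin n, ∑ α, (∑ i, e s i * d1 u α i x) * ∑ i, e t i * d1 u α i x =
        if s = t then singularValue u x s ^ 2 else 0) ∧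
      (∀ i j, inverseMetric u x i j =
        ∑ s : Fin n, (1 + singularValue u x s ^ 2)⁻¹ * (e s i * e s j)) ∧
      (inducedMetric u x).det = ∏ s : Fin n, (1 + singularValue u x s ^ 2) := by
  set T : EuclideanSpace ℝ (Fin n) →ₗ[ℝ] EuclideanSpace ℝ (Fin m) :=
    (fderiv ℝ u x).toLinearMap with hT
  have hn : Module.finrank ℝ (EuclideanSpace ℝ (Fin n)) = n := finrank_euclideanSpace_fin
  -- The frame consists of eigenvectors of `duᵀdu`. It diagonalizes `g = 1 + duᵀdu`, and the images
  -- `du(e_s)` are orthogonal of length `λ_s`.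
  set b := T.isSymmetric_adjoint_comp_self.eigenvectorBasis hn with hb
  have hTb : ∀ s α, (T (b s)) α = ∑ i, b s i * d1 u α i x := by
    intro s α
    have h1 : HasFDerivAt (fun y => u y α)
        ((EuclideanSpace.proj (𝕜 := ℝ) α).comp (fderiv ℝ u x)) x :=
      (EuclideanSpace.proj (𝕜 := ℝ) α).hasFDerivAt.comp x
        (hu.differentiable (by simp) x).hasFDerivAt
    have h2 := fderiv_apply_eq_sum (fun y => u y α) x (b s)
    rw [h1.fderiv] at h2
    exact h2
  have h2 : ∀ s t, ∑ i, b s i * b t i = if s = t then 1 else 0 := by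
    intro s t
    rw [← orthonormal_iff_ite.1 b.orthonormal s t, PiLp.inner_apply]
    exact Finset.sum_congr rfl fun i _ => by simp [mul_comm]
  have h3 : ∀ s t, ∑ α, (∑ i, b s i * d1 u α i x) * ∑ i, b t i * d1 u α i x =
      if s = t then singularValue u x s ^ 2 else 0 := by
    intro s t
    have e1 : ∑ α, (∑ i, b s i * d1 u α i x) * ∑ i, b t i * d1 u α i x =
        inner ℝ (T (b s)) (T (b t)) := by
      rw [PiLp.inner_apply]
      refine Finset.sum_congr rfl fun α _ => ?_
      rw [← hTb, ← hTb, RCLike.inner_apply, conj_trivial, mul_comm]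
    rw [e1, ← LinearMap.adjoint_inner_left]
    have e2 : (LinearMap.adjoint T) (T (b s)) =
        (T.isSymmetric_adjoint_comp_self.eigenvalues hn s) • b s :=
      T.isSymmetric_adjoint_comp_self.apply_eigenvectorBasis hn s
    rw [e2, real_inner_smul_left, orthonormal_iff_ite.1 b.orthonormal s t,
      ← T.sq_singularValues_fin hn]
    simp [singularValue, hT]
  set Q : Matrix (Fin n) (Fin n) ℝ := Matrix.of fun i s => b s i with hQ
  set γ : Fin n → ℝ := fun s => 1 + singularValue u x s ^ 2 with hγ
  have hγ0 : ∀ s, γ s ≠ 0 := fun s => by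
    simp only [hγ]
    positivity
  have hQQ : Q.transpose * Q = 1 := by
    ext s t
    simp [Matrix.mul_apply, hQ, h2, Matrix.one_apply]
  have hQQ' : Q * Q.transpose = 1 := mul_eq_one_comm.1 hQQ
  have h1 : ∀ i j, ∑ s, b s i * b s j = if i = j then 1 else 0 := by
    intro i j
    have := congrFun (congrFun hQQ' i) j
    simpa [Matrix.mul_apply, hQ, Matrix.one_apply] using this
  set P : Matrix (Fin m) (Fin n) ℝ := Matrix.of fun α i => d1 u α i x with hP
  have hg : inducedMetric u x = 1 + P.transpose * P := by
    ext i j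
    simp [inducedMetric, Matrix.mul_apply, Matrix.one_apply, hP]
  have hPQ : (P * Q).transpose * (P * Q) =
      Matrix.diagonal fun s : Fin n => singularValue u x s ^ 2 := by
    have e1 : ∀ α s, (P * Q) α s = ∑ i, b s i * d1 u α i x := fun α s => by
      rw [Matrix.mul_apply]
      exact Finset.sum_congr rfl fun i _ => mul_comm _ _
    ext s t
    rw [Matrix.mul_apply, Matrix.diagonal_apply, ← h3]
    simp only [Matrix.transpose_apply, e1]
  have hdiag : Q.transpose * inducedMetric u x * Q = Matrix.diagonal γ := by
    rw [hg, Matrix.mul_add, Matrix.add_mul, Matrix.mul_one, hQQ]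
    have : Q.transpose * (P.transpose * P) * Q = (P * Q).transpose * (P * Q) := by
      rw [Matrix.transpose_mul]
      simp only [Matrix.mul_assoc]
    rw [this, hPQ, ← Matrix.diagonal_one, Matrix.diagonal_add]
  have hinv : inverseMetric u x = Q * Matrix.diagonal (fun s => (γ s)⁻¹) * Q.transpose := by
    refine Matrix.inv_eq_right_inv ?_
    have e1 : inducedMetric u x * Q = Q * Matrix.diagonal γ := by
      rw [← hdiag, ← Matrix.mul_assoc, ← Matrix.mul_assoc, hQQ', Matrix.one_mul]
    rw [← Matrix.mul_assoc, ← Matrix.mul_assoc, e1, Matrix.mul_assoc Q, Matrix.diagonal_mul_diagonal]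
    simp [hγ0, hQQ']
  refine ⟨fun s i => b s i, h1, h2, h3, fun i j => ?_, ?_⟩
  · rw [hinv, Matrix.mul_apply]
    refine Finset.sum_congr rfl fun s _ => ?_
    simp [Matrix.mul_diagonal, hQ]
    ring
  · have e1 := congrArg Matrix.det hdiag
    rw [Matrix.det_mul, Matrix.det_mul, Matrix.det_diagonal] at e1
    have e2 := congrArg Matrix.det hQQ
    rw [Matrix.det_mul, Matrix.det_one] at e2
    rw [← e1, mul_right_comm, e2, one_mul]

/-! ### The second fundamental form in a singular value frame and the Bochner formula. -/

/-- Bessel's inequality for an orthogonal family that may contain zero vectors. -/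
theorem sum_sq_div_le_sum_sq {lam : Fin n → ℝ} {q : Fin n → Fin m → ℝ}
    (hq : ∀ s t, ∑ α, q s α * q t α = if s = t then lam s ^ 2 else 0) (v : Fin m → ℝ) :
    ∑ a, (∑ α, q a α * v α) ^ 2 / lam a ^ 2 ≤ ∑ α, v α ^ 2 := by
  set β : Fin n → ℝ := fun a => ∑ α, q a α * v α with hβ
  -- For `lam a = 0` the vector `q a` vanishes and division by zero gives coefficient 0.
  set c : Fin n → ℝ := fun a => β a / lam a ^ 2 with hc
  have h0 : 0 ≤ ∑ α, (v α - ∑ a, c a * q a α) ^ 2 := Finset.sum_nonneg fun α _ => sq_nonneg _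
  have h1 : ∑ α, v α * ∑ a, c a * q a α = ∑ a, c a * β a := by
    simp only [hβ, Finset.mul_sum]
    rw [Finset.sum_comm]
    exact Finset.sum_congr rfl fun a _ => Finset.sum_congr rfl fun α _ => by ring
  have h2 : ∑ α, (∑ a, c a * q a α) ^ 2 = ∑ a, c a ^ 2 * lam a ^ 2 := by
    calc _ = ∑ α, ∑ a, ∑ b, c a * c b * (q a α * q b α) := by
          refine Finset.sum_congr rfl fun α _ => ?_
          rw [sq, Finset.sum_mul_sum]
          exact Finset.sum_congr rfl fun a _ => Finset.sum_congr rfl fun b _ => by ring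
      _ = ∑ a, ∑ b, c a * c b * ∑ α, q a α * q b α := by
          rw [Finset.sum_comm]
          refine Finset.sum_congr rfl fun a _ => ?_
          rw [Finset.sum_comm]
          exact Finset.sum_congr rfl fun b _ => (Finset.mul_sum _ _ _).symm
      _ = _ := by
          refine Finset.sum_congr rfl fun a _ => ?_
          simp only [hq, mul_ite, mul_zero, Finset.sum_ite_eq, Finset.mem_univ, if_true]
          ring
  have h3 : ∀ a, c a * β a = β a ^ 2 / lam a ^ 2 ∧ c a ^ 2 * lam a ^ 2 = β a ^ 2 / lam a ^ 2 := by
    intro a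
    by_cases h : lam a = 0
    · simp [hc, h]
    · simp only [hc]
      constructor <;> field_simp
  have h4 : ∑ α, (v α - ∑ a, c a * q a α) ^ 2 =
      ∑ α, v α ^ 2 - 2 * (∑ α, v α * ∑ a, c a * q a α) + ∑ α, (∑ a, c a * q a α) ^ 2 := by
    rw [Finset.mul_sum, ← Finset.sum_sub_distrib, ← Finset.sum_add_distrib]
    exact Finset.sum_congr rfl fun α _ => by ring
  rw [h4, h1, h2] at h0
  simp only [h3] at h0
  linarith

/-- The components of the second fundamental form in a singular value frame. -/
def secondForm (lam : Fin n → ℝ) (β : Fin n → Fin n → Fin n → ℝ) (a i k : Fin n) : ℝ :=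
  √((1 + lam a ^ 2)⁻¹ * (1 + lam i ^ 2)⁻¹ * (1 + lam k ^ 2)⁻¹) * β a i k / lam a

/-- The part of the squared second fundamental form normal to the image of `du`. -/
def normalDefect (lam : Fin n → ℝ) (β : Fin n → Fin n → Fin n → ℝ)
    (V : Fin m → Fin n → Fin n → ℝ) : ℝ :=
  ∑ i, ∑ k, (1 + lam i ^ 2)⁻¹ * (1 + lam k ^ 2)⁻¹ *
    (∑ α, V α i k ^ 2 - ∑ a, β a i k ^ 2 / lam a ^ 2)

/-- For `λ_a ≠ 0`, `secondForm` is the component along the unit normal `(-λ_a e_a,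
q_a/λ_a)/√(1+λ_a²)`, where `q_a = du(e_a)`. For `λ_a = 0` it is 0 by convention, and `hβ` keeps the
identity valid. -/
theorem mul_secondForm {lam : Fin n → ℝ} {β : Fin n → Fin n → Fin n → ℝ}
    (hβ : ∀ a, lam a = 0 → ∀ i k, β a i k = 0) (a i k : Fin n) :
    lam a * secondForm lam β a i k =
      √((1 + lam a ^ 2)⁻¹ * (1 + lam i ^ 2)⁻¹ * (1 + lam k ^ 2)⁻¹) * β a i k := by
  rw [secondForm]
  by_cases h : lam a = 0
  · simp [h, hβ a h]
  · field_simp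

theorem secondFormTrace_sq {lam : Fin n → ℝ} {β : Fin n → Fin n → Fin n → ℝ}
    (hβ : ∀ a, lam a = 0 → ∀ i k, β a i k = 0) (k : Fin n) :
    secondFormTrace lam (secondForm lam β) k ^ 2 =
      (1 + lam k ^ 2)⁻¹ * (∑ i, (1 + lam i ^ 2)⁻¹ * β i i k) ^ 2 := by
  have h1 : secondFormTrace lam (secondForm lam β) k =
      √((1 + lam k ^ 2)⁻¹) * ∑ i, (1 + lam i ^ 2)⁻¹ * β i i k := by
    rw [secondFormTrace, Finset.mul_sum]
    refine Finset.sum_congr rfl fun i _ => ?_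
    rw [mul_secondForm hβ, Real.sqrt_mul (by positivity), Real.sqrt_mul_self (by positivity)]
    ring
  rw [h1, mul_pow, Real.sq_sqrt (by positivity)]

theorem mul_mul_secondForm_mul {lam : Fin n → ℝ} {β : Fin n → Fin n → Fin n → ℝ}
    (hβ : ∀ a, lam a = 0 → ∀ i k, β a i k = 0) (a i k : Fin n) :
    lam a * lam i * (secondForm lam β a i k * secondForm lam β i a k) =
      (1 + lam a ^ 2)⁻¹ * (1 + lam i ^ 2)⁻¹ * (1 + lam k ^ 2)⁻¹ * (β a i k * β i a k) := by
  have h1 : lam a * lam i * (secondForm lam β a i k * secondForm lam β i a k) =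
      (lam a * secondForm lam β a i k) * (lam i * secondForm lam β i a k) := by ring
  rw [h1, mul_secondForm hβ, mul_secondForm hβ, mul_comm (1 + lam i ^ 2)⁻¹ (1 + lam a ^ 2)⁻¹]
  have h2 := Real.mul_self_sqrt
    (by positivity : 0 ≤ (1 + lam a ^ 2)⁻¹ * (1 + lam i ^ 2)⁻¹ * (1 + lam k ^ 2)⁻¹)
  linear_combination (β a i k * β i a k) * h2

/-- From `1/(λ²(1+λ²)) = 1/λ² - 1/(1+λ²)`. The first part is the projection to the image of `du`
subtracted in `normalDefect`; the second is a term of the Bochner formula. -/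
theorem secondForm_sq {lam : Fin n → ℝ} {β : Fin n → Fin n → Fin n → ℝ}
    (hβ : ∀ a, lam a = 0 → ∀ i k, β a i k = 0) (a i k : Fin n) :
    secondForm lam β a i k ^ 2 =
      (1 + lam i ^ 2)⁻¹ * (1 + lam k ^ 2)⁻¹ * (β a i k ^ 2 / lam a ^ 2) -
      (1 + lam a ^ 2)⁻¹ * (1 + lam i ^ 2)⁻¹ * (1 + lam k ^ 2)⁻¹ * β a i k ^ 2 := by
  rw [secondForm, div_pow, mul_pow, Real.sq_sqrt (by positivity)]
  by_cases h : lam a = 0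
  · simp [h, hβ a h]
  · have h1 : 1 + lam a ^ 2 ≠ 0 := by positivity
    have h2 : 1 + lam i ^ 2 ≠ 0 := by positivity
    have h3 : 1 + lam k ^ 2 ≠ 0 := by positivity
    field_simp
    ring

theorem normalDefect_add_secondFormQuad {lam : Fin n → ℝ} {β : Fin n → Fin n → Fin n → ℝ}
    (hβ : ∀ a, lam a = 0 → ∀ i k, β a i k = 0) (V : Fin m → Fin n → Fin n → ℝ) :
    normalDefect lam β V + secondFormQuad lam (secondForm lam β) =
      ∑ α, ∑ i, (1 + lam i ^ 2)⁻¹ * ∑ k, (1 + lam k ^ 2)⁻¹ * V α i k ^ 2 -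
      ∑ a, ∑ i, ∑ k, (1 + lam a ^ 2)⁻¹ * (1 + lam i ^ 2)⁻¹ * (1 + lam k ^ 2)⁻¹ * β a i k ^ 2 +
      ∑ a, ∑ i, ∑ k, (1 + lam a ^ 2)⁻¹ * (1 + lam i ^ 2)⁻¹ * (1 + lam k ^ 2)⁻¹ *
        (β a i k * β i a k) := by
  simp only [secondFormQuad, mul_mul_secondForm_mul hβ, secondForm_sq hβ, Finset.sum_add_distrib,
    Finset.sum_sub_distrib, normalDefect, mul_sub]
  have h1 : ∑ i, ∑ k, (1 + lam i ^ 2)⁻¹ * (1 + lam k ^ 2)⁻¹ * ∑ a, β a i k ^ 2 / lam a ^ 2 =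
      ∑ a, ∑ i, ∑ k, (1 + lam i ^ 2)⁻¹ * (1 + lam k ^ 2)⁻¹ * (β a i k ^ 2 / lam a ^ 2) := by
    simp only [Finset.mul_sum]
    exact (sum_rotate fun i k a =>
      (1 + lam i ^ 2)⁻¹ * (1 + lam k ^ 2)⁻¹ * (β a i k ^ 2 / lam a ^ 2)).symm
  have h2 : ∑ i, ∑ k, (1 + lam i ^ 2)⁻¹ * (1 + lam k ^ 2)⁻¹ * ∑ α, V α i k ^ 2 =
      ∑ α, ∑ i, (1 + lam i ^ 2)⁻¹ * ∑ k, (1 + lam k ^ 2)⁻¹ * V α i k ^ 2 := by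
    simp only [Finset.mul_sum]
    rw [Finset.sum_comm (γ := Fin m)]
    refine Finset.sum_congr rfl fun i _ => ?_
    rw [Finset.sum_comm]
    exact Finset.sum_congr rfl fun k _ => Finset.sum_congr rfl fun α _ => by ring
  rw [h1, h2]
  ring

theorem normalDefect_nonneg {lam : Fin n → ℝ} {q : Fin n → Fin m → ℝ}
    (hq : ∀ s t, ∑ α, q s α * q t α = if s = t then lam s ^ 2 else 0)
    (V : Fin m → Fin n → Fin n → ℝ) :
    0 ≤ normalDefect lam (fun a i k => ∑ α, q a α * V α i k) V :=
  Finset.sum_nonneg fun i _ => Finset.sum_nonneg fun k _ => mul_nonneg (by positivity)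
    (sub_nonneg.2 (sum_sq_div_le_sum_sq hq fun α => V α i k))

/-- Vanishing of the form kills the component of `V` along the image of `du`; vanishing of the
defect then kills the orthogonal component. -/
theorem eq_zero_of_normalDefect_eq_zero {lam : Fin n → ℝ} {q : Fin n → Fin m → ℝ}
    (hβ : ∀ a, lam a = 0 → ∀ α, q a α = 0)
    {V : Fin m → Fin n → Fin n → ℝ}
    (h0 : normalDefect lam (fun a i k => ∑ α, q a α * V α i k) V = 0)
    (h : ∀ a i k, secondForm lam (fun a i k => ∑ α, q a α * V α i k) a i k = 0)
    (α : Fin m) (i k : Fin n) : V α i k = 0 := by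
  have h1 : ∀ a i k, ∑ α, q a α * V α i k = 0 := by
    intro a i k
    by_cases hl : lam a = 0
    · exact Finset.sum_eq_zero fun α _ => by rw [hβ a hl, zero_mul]
    · have h2 := mul_secondForm (lam := lam) (β := fun a i k => ∑ α, q a α * V α i k)
        (fun a hl i k => Finset.sum_eq_zero fun α _ => by rw [hβ a hl, zero_mul]) a i k
      rw [h, mul_zero] at h2
      refine (mul_eq_zero.1 h2.symm).resolve_left ?_
      exact (Real.sqrt_pos.2 (by positivity)).ne'
  have h3 : ∀ i k, 0 ≤ (1 + lam i ^ 2)⁻¹ * (1 + lam k ^ 2)⁻¹ * ∑ α, V α i k ^ 2 := fun i k =>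
    mul_nonneg (by positivity) (Finset.sum_nonneg fun α _ => sq_nonneg _)
  simp only [normalDefect, h1, ne_eq, OfNat.ofNat_ne_zero, not_false_eq_true, zero_pow, zero_div,
    Finset.sum_const_zero, sub_zero] at h0
  have h4 := (Finset.sum_eq_zero_iff_of_nonneg fun i _ =>
    Finset.sum_nonneg fun k _ => h3 i k).1 h0 i (Finset.mem_univ i)
  have h5 := (Finset.sum_eq_zero_iff_of_nonneg fun k _ => h3 i k).1 h4 k (Finset.mem_univ k)
  have h6 : ∑ α, V α i k ^ 2 = 0 := (mul_eq_zero.1 h5).resolve_left (by positivity)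
  exact eq_zero_of_sum_sq_nonpos h6.le α (Finset.mem_univ α)

/-- When the second derivatives commute, the indefinite part of the quadratic form is the squared
gradient. -/
theorem secondFormQuad_eq_of_commute {lam : Fin n → ℝ} {q : Fin n → Fin m → ℝ}
    (hβ : ∀ a, lam a = 0 → ∀ α, q a α = 0) {V : Fin m → Fin n → Fin n → ℝ}
    (hV : ∀ α i k, V α i k = V α k i)
    (hc : ∀ α β s t, ∑ k, (1 + lam k ^ 2)⁻¹ * (V α s k * V β k t) =
      ∑ k, (1 + lam k ^ 2)⁻¹ * (V β s k * V α k t)) :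
    secondFormQuad lam (secondForm lam fun a i k => ∑ α, q a α * V α i k) =
      ∑ a, ∑ i, ∑ k, secondForm lam (fun a i k => ∑ α, q a α * V α i k) a i k ^ 2 +
      ∑ k, secondFormTrace lam (secondForm lam fun a i k => ∑ α, q a α * V α i k) k ^ 2 := by
  have hβ' : ∀ a, lam a = 0 → ∀ i k, ∑ α, q a α * V α i k = 0 := fun a hl i k =>
    Finset.sum_eq_zero fun α _ => by rw [hβ a hl, zero_mul]
  set γ : Fin n → ℝ := fun k => (1 + lam k ^ 2)⁻¹ with hγ
  simp only [secondFormQuad, Finset.sum_add_distrib]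
  congr 1
  rw [Finset.sum_congr rfl fun k _ => secondFormTrace_sq hβ' k]
  simp only [mul_mul_secondForm_mul hβ']
  -- Exchanging the codomain indices by `hc` turns the mixed products `β_{aik} β_{iak}` into
  -- `β_{aak} β_{iik}`, which sum to a square for each `k`.
  have h1 : ∀ a i, ∑ k, γ a * γ i * γ k * ((∑ α, q a α * V α i k) * ∑ β, q i β * V β a k) =
      ∑ k, γ a * γ i * γ k * ((∑ α, q a α * V α a k) * ∑ β, q i β * V β i k) := by
    intro a i
    have e : ∀ (X Y : Fin m → Fin n → ℝ),
        ∑ k, γ a * γ i * γ k * ((∑ α, q a α * X α k) * ∑ β, q i β * Y β k) =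
        γ a * γ i * ∑ α, ∑ β, q a α * q i β * ∑ k, γ k * (X α k * Y β k) := by
      intro X Y
      have e1 : ∀ k, γ a * γ i * γ k * ((∑ α, q a α * X α k) * ∑ β, q i β * Y β k) =
          ∑ α, ∑ β, γ a * γ i * (q a α * q i β * (γ k * (X α k * Y β k))) := by
        intro k
        rw [Finset.sum_mul_sum, Finset.mul_sum]
        refine Finset.sum_congr rfl fun α _ => ?_
        rw [Finset.mul_sum]
        exact Finset.sum_congr rfl fun β _ => by ring
      rw [Finset.sum_congr rfl fun k _ => e1 k]
      simp only [Finset.mul_sum]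
      rw [Finset.sum_comm]
      exact Finset.sum_congr rfl fun α _ => Finset.sum_comm
    rw [e (fun α k => V α i k) (fun β k => V β a k), e (fun α k => V α a k) (fun β k => V β i k)]
    congr 1
    refine Finset.sum_congr rfl fun α _ => Finset.sum_congr rfl fun β _ => ?_
    congr 1
    have h2 := hc α β i a
    simp only [hV _ _ a] at h2
    rw [h2]
    exact Finset.sum_congr rfl fun k _ => by ring
  rw [Finset.sum_congr rfl fun a _ => Finset.sum_congr rfl fun i _ => h1 a i]
  rw [← sum_rotate]
  refine Finset.sum_congr rfl fun k _ => ?_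
  change _ = γ k * (∑ i, γ i * ∑ α, q i α * V α i k) ^ 2
  rw [sq, Finset.sum_mul_sum, Finset.mul_sum]
  refine Finset.sum_congr rfl fun a _ => ?_
  rw [Finset.mul_sum]
  exact Finset.sum_congr rfl fun i _ => by ring

/-- The Bochner-type formula for the logarithm of the volume element, in a singular value frame. -/
theorem exists_secondForm {u : EuclideanSpace ℝ (Fin n) → EuclideanSpace ℝ (Fin m)}
    (hu : ContDiff ℝ ∞ u) (hs : IsSelfShrinkerSolution u) (x : EuclideanSpace ℝ (Fin n)) :
    ∃ (h : Fin n → Fin n → Fin n → ℝ) (R : ℝ), 0 ≤ R ∧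
      (∀ a i k, h a i k = h a k i) ∧
      driftOp (inverseMetric u) (logVolume u) x =
        R + secondFormQuad (fun i : Fin n => singularValue u x i) h ∧
      gradSq (inverseMetric u) (logVolume u) x =
        ∑ k, secondFormTrace (fun i : Fin n => singularValue u x i) h k ^ 2 ∧
      (R = 0 → (∀ a i k, h a i k = 0) → ∀ α i j, d2 u α i j x = 0) ∧
      (SecondDerivativesCommute u →
        secondFormQuad (fun i : Fin n => singularValue u x i) h = ∑ a, ∑ i, ∑ k, h a i k ^ 2 +
          ∑ k, secondFormTrace (fun i : Fin n => singularValue u x i) h k ^ 2) := by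
  obtain ⟨e, he, -, hq, hG, -⟩ := exists_singular_frame hu x
  set lam : Fin n → ℝ := fun i => singularValue u x i with hlam
  set q : Fin n → Fin m → ℝ := fun s α => ∑ i, e s i * d1 u α i x with hqd
  set V : Fin m → Fin n → Fin n → ℝ := fun α => rotate₂ e fun i j => d2 u α i j x with hVd
  set β : Fin n → Fin n → Fin n → ℝ := fun a i k => ∑ α, q a α * V α i k with hβd
  have hq' : ∀ s t, ∑ α, q s α * q t α = if s = t then lam s ^ 2 else 0 := hq
  have hG' : ∀ i j, inverseMetric u x i j = ∑ s, (1 + lam s ^ 2)⁻¹ * (e s i * e s j) := hG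
  have hV : ∀ α i k, V α i k = V α k i := fun α i k =>
    rotate₂_comm (fun i j => by rw [d2_comm hu]) i k
  have hq0 : ∀ a, lam a = 0 → ∀ α, q a α = 0 := fun a hl α => by
    have h1 := hq' a a
    simp only [if_true, hl, ne_eq, OfNat.ofNat_ne_zero, not_false_eq_true, zero_pow, ← sq] at h1
    exact eq_zero_of_sum_sq_nonpos h1.le α (Finset.mem_univ α)
  have hβ0 : ∀ a, lam a = 0 → ∀ i k, β a i k = 0 := fun a hl i k =>
    Finset.sum_eq_zero fun α _ => by rw [hq0 a hl, zero_mul]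
  have hβs : ∀ a i k, β a i k = β a k i := fun a i k =>
    Finset.sum_congr rfl fun α _ => by rw [hV]
  have hrot : ∀ s t r, rotate₃ e (gradHess u x) s t r = β s t r := fun s t r =>
    rotate₃_eq_sum_mul e (fun α i => d1 u α i x) (fun α i j => d2 u α i j x) s t r
  refine ⟨secondForm lam β, normalDefect lam β V, normalDefect_nonneg hq' V, ?_, ?_, ?_, ?_, ?_⟩
  · intro a i k
    rw [secondForm, secondForm, hβs, mul_right_comm]
  · rw [normalDefect_add_secondFormQuad hβ0, driftOp_logVolume hu hs]
    simp only [contract₂_eq_sum hG', contract₃_eq_sum hG']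
    have h1 : ∀ s t r, rotate₃ e (fun a b l => gradHess u x a b l + gradHess u x b a l) s t r =
        β s t r + β t s r := fun s t r => by
      rw [rotate₃_add e (gradHess u x) fun a b l => gradHess u x b a l, hrot,
        rotate₃_swap e (gradHess u x), hrot]
    have h2 : ∀ s t r, rotate₃ e (fun i j k => gradHess u x k i j) s t r = β r s t :=
      fun s t r => by rw [rotate₃_rotate, hrot]
    have h3 : ∀ s t r, rotate₃ e (fun i j k => gradHess u x i j k) s t r = β s t r := hrot
    simp only [h1, h2, h3, mul_add, Finset.sum_add_distrib]
    -- Both cross products from the shrinker system relabel to `∑ g`, and the derivative of `g⁻¹`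
    -- contributes `-∑ g`, so one copy survives.
    set g : Fin n → Fin n → Fin n → ℝ := fun a i k =>
      (1 + lam a ^ 2)⁻¹ * (1 + lam i ^ 2)⁻¹ * (1 + lam k ^ 2)⁻¹ * (β a i k * β i a k) with hg
    have h4 : ∑ s, ∑ t, ∑ r, (1 + lam s ^ 2)⁻¹ * (1 + lam t ^ 2)⁻¹ * (1 + lam r ^ 2)⁻¹ *
        (β r s t * β s t r) = ∑ a, ∑ i, ∑ k, g a i k := by
      rw [← sum_rotate g, ← sum_rotate fun a i k => g i k a]
      refine Finset.sum_congr rfl fun s _ => Finset.sum_congr rfl fun t _ =>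
        Finset.sum_congr rfl fun r _ => ?_
      simp only [hg]
      rw [hβs s t r]
      ring
    have h5 : ∑ s, ∑ t, ∑ r, (1 + lam s ^ 2)⁻¹ * (1 + lam t ^ 2)⁻¹ * (1 + lam r ^ 2)⁻¹ *
        (β r s t * β t s r) = ∑ a, ∑ i, ∑ k, g a i k := by
      rw [← sum_rotate g]
      refine Finset.sum_congr rfl fun s _ => Finset.sum_congr rfl fun t _ =>
        Finset.sum_congr rfl fun r _ => ?_
      simp only [hg]
      rw [hβs t s r, hβs r s t]
      ring
    rw [h4, h5]
    have h6 : ∀ a i k, (1 + lam a ^ 2)⁻¹ * (1 + lam i ^ 2)⁻¹ * (1 + lam k ^ 2)⁻¹ *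
        (β a i k * β i a k) = g a i k := fun _ _ _ => rfl
    simp only [h6, ← sq]
    simp only [hVd]
    ring
  · simp only [secondFormTrace_sq hβ0]
    rw [gradSq_logVolume hu, contract_mul_eq_sum hG']
    refine Finset.sum_congr rfl fun r _ => ?_
    have h1 : ∑ k, e r k * ∑ i, ∑ j, inverseMetric u x i j * gradHess u x i j k =
        ∑ s, (1 + lam s ^ 2)⁻¹ * β s s r := by
      simp only [contract_eq_sum hG', Finset.mul_sum (s := Finset.univ (α := Fin n)), ← hrot,
        rotate₃]
      rw [Finset.sum_comm]
      exact Finset.sum_congr rfl fun s _ => Finset.sum_congr rfl fun k _ =>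
        Finset.sum_congr rfl fun i _ => Finset.sum_congr rfl fun j _ => by ring
    rw [h1]
    ring
  · intro hR hh α i j
    exact eq_zero_of_rotate₂_eq_zero he
      (fun s t => eq_zero_of_normalDefect_eq_zero hq0 hR hh α s t) i j
  · intro hcomm
    refine secondFormQuad_eq_of_commute hq0 hV fun α α' s t => ?_
    have key : ∀ α α', ∑ k, (1 + lam k ^ 2)⁻¹ * (V α s k * V α' k t) =
        ∑ a, e s a * ∑ p, e t p *
          ∑ i, ∑ j, d2 u α a i x * inverseMetric u x i j * d2 u α' j p x := by
      intro α α'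
      have h1 : ∀ a p, ∑ i, ∑ j, d2 u α a i x * inverseMetric u x i j * d2 u α' j p x =
          ∑ k, (1 + lam k ^ 2)⁻¹ *
            ((∑ i, e k i * d2 u α a i x) * ∑ j, e k j * d2 u α' j p x) := by
        intro a p
        rw [← contract_mul_eq_sum hG']
        exact Finset.sum_congr rfl fun i _ => Finset.sum_congr rfl fun j _ => by ring
      have h2 : ∀ k, V α s k = ∑ a, e s a * ∑ i, e k i * d2 u α a i x := by
        intro k
        rw [hV]
        simp only [hVd, rotate₂]
        refine Finset.sum_congr rfl fun a _ => ?_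
        congr 1
        exact Finset.sum_congr rfl fun i _ => by rw [d2_comm hu]
      have h3 : ∀ k, V α' k t = ∑ p, e t p * ∑ j, e k j * d2 u α' j p x := fun k => rfl
      simp only [h1, h2, h3]
      have h4 : ∀ k, (1 + lam k ^ 2)⁻¹ * ((∑ a, e s a * ∑ i, e k i * d2 u α a i x) *
          ∑ p, e t p * ∑ j, e k j * d2 u α' j p x) =
          ∑ a, ∑ p, e s a * (e t p * ((1 + lam k ^ 2)⁻¹ *
            ((∑ i, e k i * d2 u α a i x) * ∑ j, e k j * d2 u α' j p x))) := by
        intro k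
        rw [Finset.sum_mul_sum, Finset.mul_sum]
        refine Finset.sum_congr rfl fun a _ => ?_
        rw [Finset.mul_sum]
        exact Finset.sum_congr rfl fun p _ => by ring
      simp only [h4]
      rw [Finset.sum_comm]
      refine Finset.sum_congr rfl fun a _ => ?_
      rw [Finset.sum_comm, Finset.mul_sum]
      refine Finset.sum_congr rfl fun p _ => ?_
      rw [Finset.mul_sum, Finset.mul_sum]
    rw [key, key]
    simp only [hcomm x α α']

/-! ### Vanishing of the Hessian and linearity of the graph. -/

theorem trace_inverseMetric_le {u : EuclideanSpace ℝ (Fin n) → EuclideanSpace ℝ (Fin m)}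
    (hu : ContDiff ℝ ∞ u) (x : EuclideanSpace ℝ (Fin n)) : (inverseMetric u x).trace ≤ n := by
  obtain ⟨e, -, he, -, hG, -⟩ := exists_singular_frame hu x
  have h1 : (inverseMetric u x).trace = ∑ s : Fin n, (1 + singularValue u x s ^ 2)⁻¹ := by
    simp only [Matrix.trace, Matrix.diag_apply, hG]
    rw [Finset.sum_comm]
    refine Finset.sum_congr rfl fun s _ => ?_
    rw [← Finset.mul_sum, he]
    simp
  rw [h1]
  calc _ ≤ ∑ _s : Fin n, (1 : ℝ) := Finset.sum_le_sum fun s _ =>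
        inv_le_one_of_one_le₀ (le_add_of_nonneg_right (sq_nonneg _))
    _ = n := by simp

/-- If, for a suitable `t`, the quadratic form `A + t |S|²` is definite on the second fundamental
forms, then all second derivatives of the solution vanish. -/
theorem d2_eq_zero_of_definite {u : EuclideanSpace ℝ (Fin n) → EuclideanSpace ℝ (Fin m)}
    (hu : ContDiff ℝ ∞ u) (hs : IsSelfShrinkerSolution u) {t : ℝ} (ht : t ≠ 0) {C : ℝ}
    (hC : ∀ x, t⁻¹ * Real.exp (t * logVolume u x) ≤ C)
    (hdef : ∀ x (h : Fin n → Fin n → Fin n → ℝ), (∀ a i k, h a i k = h a k i) →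
      (SecondDerivativesCommute u →
        secondFormQuad (fun i : Fin n => singularValue u x i) h = ∑ a, ∑ i, ∑ k, h a i k ^ 2 +
          ∑ k, secondFormTrace (fun i : Fin n => singularValue u x i) h k ^ 2) →
      secondFormQuad (fun i : Fin n => singularValue u x i) h +
        t * ∑ k, secondFormTrace (fun i : Fin n => singularValue u x i) h k ^ 2 ≤ 0 →
      ∀ a i k, h a i k = 0)
    (x : EuclideanSpace ℝ (Fin n)) (α : Fin m) (i j : Fin n) : d2 u α i j x = 0 := by
  have key : ∀ x, 0 ≤ driftOp (inverseMetric u) (logVolume u) x +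
      t * gradSq (inverseMetric u) (logVolume u) x ∧
      (driftOp (inverseMetric u) (logVolume u) x +
        t * gradSq (inverseMetric u) (logVolume u) x = 0 → ∀ α i j, d2 u α i j x = 0) := by
    intro x
    obtain ⟨h, R, hR, hsym, hL, hg, hz, hcomm⟩ := exists_secondForm hu hs x
    set E := secondFormQuad (fun i : Fin n => singularValue u x i) h +
        t * ∑ k, secondFormTrace (fun i : Fin n => singularValue u x i) h k ^ 2 with hE
    have hE0 : E ≤ 0 → ∀ a i k, h a i k = 0 := hdef x h hsym hcomm
    have hEn : 0 ≤ E := by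
      by_contra hcon
      push Not at hcon
      have h0 := hE0 hcon.le
      simp [hE, secondFormQuad, secondFormTrace, h0] at hcon
    have hsum : driftOp (inverseMetric u) (logVolume u) x +
        t * gradSq (inverseMetric u) (logVolume u) x = R + E := by
      rw [hL, hg, hE]
      ring
    rw [hsum]
    exact ⟨by linarith, fun h0 => hz (by linarith) (hE0 (by linarith))⟩
  have hconst := eq_of_driftOp_add_gradSq_nonneg
    (fun i j => (contDiff_inverseMetric hu i j).continuous) (inverseMetric_posDef u)
    (trace_inverseMetric_le hu) (contDiff_logVolume hu) ht (fun x => (key x).1) hC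
  refine (key x).2 ?_ α i j
  -- For constant `logVolume u` both the drift term and the gradient vanish, which is the equality
  -- case in `key`.
  have hfun : logVolume u = fun _ => logVolume u x := funext fun y => hconst y x
  rw [hfun]
  simp only [driftOp, gradSq, partialDeriv_const]
  simp

theorem exists_submodule_eq_graph_of_d2_eq_zero
    {u : EuclideanSpace ℝ (Fin n) → EuclideanSpace ℝ (Fin m)} (hu : ContDiff ℝ ∞ u)
    (hs : IsSelfShrinkerSolution u) (hd2 : ∀ x α i j, d2 u α i j x = 0) :
    ∃ S : Submodule ℝ (WithLp 2 (EuclideanSpace ℝ (Fin n) × EuclideanSpace ℝ (Fin m))),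
      (S : Set (WithLp 2 (EuclideanSpace ℝ (Fin n) × EuclideanSpace ℝ (Fin m)))) = graph u := by
  have hd1 : ∀ α i x y, d1 u α i x = d1 u α i y := by
    intro α i
    refine is_const_of_fderiv_eq_zero (𝕜 := ℝ) (contDiff_smooth_differentiable (contDiff_d1 hu α i))
      fun x => ?_
    ext v
    rw [fderiv_apply_eq_sum]
    exact Finset.sum_eq_zero fun j _ => by
      rw [partialDeriv_d1, hd2, mul_zero]
  -- With zero Hessian the system reads `u = x·Du`, and `Du` is constant; this also excludes a
  -- constant term in `u`.
  have hlin : ∀ x α, u x α = ∑ i, x i * d1 u α i 0 := by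
    intro x α
    have h1 := hs x α
    simp only [hd2, mul_zero, Finset.sum_const_zero] at h1
    have h2 : ∑ i, x i * d1 u α i x = ∑ i, x i * d1 u α i 0 :=
      Finset.sum_congr rfl fun i _ => by rw [hd1 α i x 0]
    linarith
  have hadd : ∀ x y, u (x + y) = u x + u y := fun x y => by
    ext α
    simp only [PiLp.add_apply, hlin, add_mul, Finset.sum_add_distrib]
  have hsmul : ∀ (c : ℝ) x, u (c • x) = c • u x := fun c x => by
    ext α
    simp only [PiLp.smul_apply, hlin, smul_eq_mul, Finset.mul_sum, mul_assoc]
  refine ⟨LinearMap.range ((WithLp.linearEquiv 2 ℝ _).symm.toLinearMap ∘ₗ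
    LinearMap.prod LinearMap.id ({ toFun := u, map_add' := hadd, map_smul' := hsmul } :
      EuclideanSpace ℝ (Fin n) →ₗ[ℝ] EuclideanSpace ℝ (Fin m))), ?_⟩
  ext z
  rfl

end

end ShrinkerGraph

theorem mainTheorem3 {n m : ℕ}
    (u : EuclideanSpace ℝ (Fin n) → EuclideanSpace ℝ (Fin m))
    (hsmooth : ContDiff ℝ ∞ u)
    (hu : ShrinkerGraph.IsSelfShrinkerSolution u)
    (hcond :
      (∀ (x : EuclideanSpace ℝ (Fin n)) (i j : ℕ), i ≠ j →
        ShrinkerGraph.singularValue u x i * ShrinkerGraph.singularValue u x j ≤ 1) ∨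
      (∃ β : ℝ, 0 < β ∧ β < 9 ∧
        ∀ x : EuclideanSpace ℝ (Fin n), (ShrinkerGraph.inducedMetric u x).det ≤ β) ∨
      ShrinkerGraph.SecondDerivativesCommute u) :
    ∃ S : Submodule ℝ (WithLp 2 (EuclideanSpace ℝ (Fin n) × EuclideanSpace ℝ (Fin m))),
      (S : Set (WithLp 2 (EuclideanSpace ℝ (Fin n) × EuclideanSpace ℝ (Fin m)))) =
        ShrinkerGraph.graph u := by
  refine ShrinkerGraph.exists_submodule_eq_graph_of_d2_eq_zero hsmooth hu ?_
  rcases hcond with hle | ⟨β, -, hβ, hdet⟩ | hcomm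
  · have hn : (0 : ℝ) < (n : ℝ) + 1 := by positivity
    have ht : -(1 / ((n : ℝ) + 1)) < 0 := neg_neg_of_pos (by positivity)
    refine ShrinkerGraph.d2_eq_zero_of_definite hsmooth hu (t := -(1 / ((n : ℝ) + 1))) ht.ne
      (C := 0) (fun x => mul_nonpos_of_nonpos_of_nonneg (inv_nonpos.2 ht.le) (Real.exp_pos _).le)
      fun x h hs _ hE => ?_
    exact ShrinkerGraph.eq_zero_of_pairwise_mul_le_one
      (fun i => LinearMap.singularValues_nonneg _ _)
      (fun i j hij => hle x i j fun h => hij (Fin.ext h)) hs hE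
  · refine ShrinkerGraph.d2_eq_zero_of_definite hsmooth hu (t := 2) two_ne_zero (C := 2⁻¹ * β)
      (fun x => ?_) fun x h hs _ hE => ?_
    · have h1 : 2 * ShrinkerGraph.logVolume u x =
          Real.log (ShrinkerGraph.inducedMetric u x).det := by
        rw [ShrinkerGraph.logVolume]
        ring
      rw [h1, Real.exp_log (ShrinkerGraph.inducedMetric_det_pos u x)]
      linarith [hdet x]
    · obtain ⟨-, -, -, -, -, hprod⟩ := ShrinkerGraph.exists_singular_frame hsmooth x
      exact ShrinkerGraph.eq_zero_of_prod_lt_nine (by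
        rw [← hprod]
        exact (hdet x).trans_lt hβ) hs hE
  · refine ShrinkerGraph.d2_eq_zero_of_definite hsmooth hu (t := -1) (by norm_num) (C := 0)
      (fun x => mul_nonpos_of_nonpos_of_nonneg (by norm_num) (Real.exp_pos _).le)
      fun x h _ hq hE => ?_
    have h1 : ∑ p : Fin n × Fin n × Fin n, h p.1 p.2.1 p.2.2 ^ 2 ≤ 0 := by
      simp only [Fintype.sum_prod_type]
      linarith [hq hcomm]
    exact fun a i k => ShrinkerGraph.eq_zero_of_sum_sq_nonpos h1 (a, i, k) (Finset.mem_univ _)
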